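/- Let $(X,T)$ be a topological dynamical system, that is, $X$ is a compact metric space and $T\colon X\to X$ is a homeomorphism. Suppose that $(X,T)$ has zero topological entropy and only countably many ergodic invariant Borel probability measures. Let $r\colon X\to(0,\infty)$ be continuous, let $X_r$ be the quotient of $\{(x,s): x\in X,\ 0\le s\le r(x)\}$ in which $(x,r(x))$ and $(Tx,0)$ are identified for every $x\in X$, with the quotient topology, and let $(\varphi_t)_{t\in\mathbb R}$ be the suspension flow on $X_r$, $$\varphi_t(x,s)=\bigl(T^nx,\ s+t-r_n(x)\bigr),$$ where $r_n(x)=\sum_{i=0}^{n-1}r(T^ix)$ for $n\ge 0$, $r_n(x)=-\sum_{i=1}^{|n|}r(T^{-i}x)$ for $n<0$, and $n\in\mathbb Z$ is the unique integer with $r_n(x)\le s+t<r_{n+1}(x)$. Then the time-one map $\varphi_1$ of $X_r$ has zero topological entropy and almost countable spectrum. The latter means that for every $\varphi_1$-invariant Borel probability measure $\mu$ on $X_r$ there is a countable subset $C_\mu$ of the unit circle such that, if $\mu=\int m\,d\tau(m)$ is the ergodic decomposition of $\mu$ with respect to $\varphi_1$, then for $\tau$-almost every ergodic measure $m$ all eigenvalues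 of the Koopman operator $f\mapsto f\circ\varphi_1$ on $L^2(m)$ lie in $C_\mu$. -/

import Mathlib

/-! # Suspension flows -/

namespace Suspension

section

variable {X : Type*} [TopologicalSpace X]

/-- The Birkhoff cocycle `r_n(x)` of the roof function `r`:
`r_n(x) = r(x) + r(T x) + ... + r(T^(n-1) x)` for `n ≥ 0` (so `r_0 = 0`), and
`r_n(x) = -(r(T^(-1) x) + ... + r(T^n x))` for `n < 0`. -/
def roofSum (T : X ≃ₜ X) (r : C(X, Set.Ioi (0 : ℝ))) : ℤ → X → ℝ
  | Int.ofNat n, x => ∑ i ∈ Finset.range n, (r ((T ^ (i : ℤ)) x) : ℝ)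
  | Int.negSucc n, x => -∑ i ∈ Finset.Icc 1 (n + 1), (r ((T ^ (-(i : ℤ))) x) : ℝ)

/-- The closed region `{(x, s) : 0 ≤ s ≤ r x}` under the graph of the roof function. -/
abbrev Region (r : C(X, Set.Ioi (0 : ℝ))) : Type _ :=
  {p : X × ℝ // 0 ≤ p.2 ∧ p.2 ≤ r p.1}

/-- The gluing relation: `(x, r x)` is glued to `(T x, 0)`. -/
def Glue (T : X ≃ₜ X) (r : C(X, Set.Ioi (0 : ℝ))) (p q : Region r) : Prop :=
  p.1.2 = r p.1.1 ∧ q.1 = (T p.1.1, 0)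

/-- The suspension space `X_r`: the region `{(x, s) : 0 ≤ s ≤ r x}` with `(x, r x)` and `(T x, 0)`
identified for every `x` (the quotient by the equivalence relation generated by `Glue`). -/
def Space (T : X ≃ₜ X) (r : C(X, Set.Ioi (0 : ℝ))) : Type _ := Quot (Glue T r)

/-- The topology of `X_r` is the quotient topology (it is the topology of the Bowen--Walters
metric). -/
instance (T : X ≃ₜ X) (r : C(X, Set.Ioi (0 : ℝ))) : TopologicalSpace (Space T r) :=
  inferInstanceAs (TopologicalSpace (Quot (Glue T r)))

/-- The measurable structure of `X_r` is its Borel `σ`-algebra. -/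
instance (T : X ≃ₜ X) (r : C(X, Set.Ioi (0 : ℝ))) : MeasurableSpace (Space T r) :=
  borel (Space T r)

instance (T : X ≃ₜ X) (r : C(X, Set.Ioi (0 : ℝ))) : BorelSpace (Space T r) := ⟨rfl⟩

variable (T : X ≃ₜ X) (r : C(X, Set.Ioi (0 : ℝ)))

/-- The class in `X_r` of a point of the region. -/
def mk (p : Region r) : Space T r := Quot.mk (Glue T r) p

@[simp] theorem roofSum_zero (x : X) : roofSum T r 0 x = 0 := by
  change ∑ i ∈ Finset.range 0, (r ((T ^ (i : ℤ)) x) : ℝ) = 0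
  simp

theorem roofSum_add_one (n : ℤ) (x : X) :
    roofSum T r (n + 1) x = roofSum T r n x + r ((T ^ n) x) := by
  cases n with
  | ofNat n =>
    change ∑ i ∈ Finset.range (n + 1), (r ((T ^ (i : ℤ)) x) : ℝ) = _
    rw [Finset.sum_range_succ]
    rfl
  | negSucc n =>
    cases n with
    | zero =>
      change roofSum T r 0 x = -∑ i ∈ Finset.Icc 1 (0 + 1), (r ((T ^ (-(i : ℤ))) x) : ℝ) + _
      simp
    | succ n =>
      change -∑ i ∈ Finset.Icc 1 (n + 1), (r ((T ^ (-(i : ℤ))) x) : ℝ) =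
        -∑ i ∈ Finset.Icc 1 (n + 1 + 1), (r ((T ^ (-(i : ℤ))) x) : ℝ) + _
      rw [Finset.sum_Icc_succ_top (b := n + 1) (by omega)]
      have : (Int.negSucc (n + 1)) = -((n + 1 + 1 : ℕ) : ℤ) := rfl
      rw [this]
      ring

/-- The homeomorphism `(x, s) ↦ (T x, s - r x)` of `X × ℝ`, whose powers are
`(x, s) ↦ (T^n x, s - r_n(x))`. -/
def shift : X × ℝ ≃ₜ X × ℝ where
  toFun p := (T p.1, p.2 - r p.1)
  invFun p := (T.symm p.1, p.2 + r (T.symm p.1))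
  left_inv p := by simp
  right_inv p := by simp

theorem shift_zpow (n : ℤ) (p : X × ℝ) :
    (shift T r ^ n) p = ((T ^ n) p.1, p.2 - roofSum T r n p.1) := by
  have key : ∀ n : ℤ, shift T r ((T ^ n) p.1, p.2 - roofSum T r n p.1) =
      ((T ^ (n + 1)) p.1, p.2 - roofSum T r (n + 1) p.1) := by
    intro n
    rw [roofSum_add_one, add_comm n 1, zpow_one_add]
    change ((T ((T ^ n) p.1)), _) = ((T ((T ^ n) p.1)), _)
    congr 1
    change p.2 - roofSum T r n p.1 - r ((T ^ n) p.1) = _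
    ring
  induction n with
  | zero => simp
  | succ n ih =>
    rw [← key, ← ih, add_comm (n : ℤ) 1, zpow_one_add]
    rfl
  | pred n ih =>
    apply (shift T r).injective
    rw [key, sub_add_cancel, ← ih]
    change (shift T r * shift T r ^ (-(n : ℤ) - 1)) p = _
    rw [← zpow_one_add, add_sub_cancel]

theorem le_roofSum_sub {c : ℝ} (hc : ∀ x, c ≤ r x) {m n : ℤ} (hmn : m ≤ n) (x : X) :
    c * (n - m) ≤ roofSum T r n x - roofSum T r m x := by
  induction n, hmn using Int.leInduction with
  | base => simp
  | succ n _ ih =>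
    rw [roofSum_add_one]
    push_cast
    linarith [hc ((T ^ n) x)]

theorem roofSum_mono {m n : ℤ} (hmn : m ≤ n) (x : X) : roofSum T r m x ≤ roofSum T r n x := by
  have := le_roofSum_sub T r (c := 0) (fun x => (Set.mem_Ioi.1 (r x).2).le) hmn x
  linarith

theorem continuous_mk : Continuous (mk T r) := continuous_quot_mk

theorem continuous_roofSum (n : ℤ) : Continuous (roofSum T r n) := by
  have h : roofSum T r n = fun x => -((shift T r ^ n) (x, 0)).2 := by
    funext x
    rw [shift_zpow]
    simp
  rw [h]
  fun_prop

variable [CompactSpace X]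

theorem exists_pos_le_roof : ∃ c : ℝ, 0 < c ∧ ∀ x, c ≤ r x := by
  rcases isEmpty_or_nonempty X with h | h
  · exact ⟨1, one_pos, fun x => (h.false x).elim⟩
  · obtain ⟨x₀, -, h₀⟩ := isCompact_univ.exists_isMinOn Set.univ_nonempty
      (f := fun x => (r x : ℝ)) (by fun_prop)
    exact ⟨r x₀, Set.mem_Ioi.1 (r x₀).2, fun x => h₀ (Set.mem_univ x)⟩

theorem exists_index (x : X) (t : ℝ) :
    ∃! n : ℤ, roofSum T r n x ≤ t ∧ t < roofSum T r (n + 1) x := by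
  obtain ⟨c, hc, hr⟩ := exists_pos_le_roof r
  obtain ⟨M, hM⟩ := exists_nat_gt (|t| / c)
  have hM' : |t| < c * M := by rwa [div_lt_iff₀ hc, mul_comm] at hM
  obtain ⟨n, hn, hn'⟩ := Int.exists_greatest_of_bdd (P := fun n => roofSum T r n x ≤ t)
    ⟨M, fun z hz => by
      by_contra! hlt
      have h1 := le_roofSum_sub T r hr (m := 0) (n := M) (by omega) x
      have h2 := roofSum_mono T r hlt.le x
      simp only [roofSum_zero, Int.cast_natCast, Int.cast_zero] at h1
      linarith [le_abs_self t]⟩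
    ⟨-M, by
      have h1 := le_roofSum_sub T r hr (m := -M) (n := 0) (by omega) x
      simp only [roofSum_zero, Int.cast_neg, Int.cast_natCast, Int.cast_zero] at h1
      linarith [neg_abs_le t]⟩
  refine ⟨n, ⟨hn, ?_⟩, ?_⟩
  · by_contra! h
    have := hn' _ h
    omega
  · rintro m ⟨hm1, hm2⟩
    refine le_antisymm (hn' m hm1) ?_
    by_contra! h
    have := roofSum_mono T r (show m + 1 ≤ n by omega) x
    linarith

/-- The unique integer `n` with `r_n(x) ≤ t < r_(n+1)(x)`. -/
noncomputable def index (x : X) (t : ℝ) : ℤ := (exists_index T r x t).choose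

theorem index_spec (x : X) (t : ℝ) :
    roofSum T r (index T r x t) x ≤ t ∧ t < roofSum T r (index T r x t + 1) x :=
  (exists_index T r x t).choose_spec.1

theorem index_eq {x : X} {t : ℝ} {n : ℤ} (h₁ : roofSum T r n x ≤ t)
    (h₂ : t < roofSum T r (n + 1) x) : index T r x t = n :=
  ((exists_index T r x t).choose_spec.2 n ⟨h₁, h₂⟩).symm

/-- The point `(T^n x, t - r_n(x))` of `X_r`, where `n` is the unique integer with
`r_n(x) ≤ t < r_(n+1)(x)`. -/
noncomputable def wrap (p : X × ℝ) : Space T r :=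
  mk T r ⟨((T ^ index T r p.1 p.2) p.1, p.2 - roofSum T r (index T r p.1 p.2) p.1), by
    have h := index_spec T r p.1 p.2
    rw [roofSum_add_one] at h
    constructor
    · simp only; linarith
    · simp only; linarith⟩

theorem wrap_eq_mk_zpow (p : X × ℝ) : ∃ (n : ℤ) (q : Region r),
    q.1 = (shift T r ^ n) p ∧ wrap T r p = mk T r q :=
  ⟨index T r p.1 p.2, _, (shift_zpow T r _ p).symm, rfl⟩

theorem wrap_shift (p : X × ℝ) : wrap T r (shift T r p) = wrap T r p := by
  have hi : index T r (shift T r p).1 (shift T r p).2 + 1 = index T r p.1 p.2 := by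
    have h := index_spec T r (shift T r p).1 (shift T r p).2
    set n := index T r (shift T r p).1 (shift T r p).2
    have e : ∀ k : ℤ, roofSum T r (k + 1) p.1 =
        roofSum T r k (shift T r p).1 + r p.1 := by
      intro k
      have h1 := shift_zpow T r k (shift T r p)
      have h2 := shift_zpow T r (k + 1) p
      rw [zpow_add_one] at h2
      change (shift T r ^ k) (shift T r p) = _ at h2
      rw [h1] at h2
      have h3 := congrArg Prod.snd h2
      change p.2 - r p.1 - _ = _ - _ at h3
      linarith
    refine (index_eq T r ?_ ?_).symm
    · rw [e]
      have : (shift T r p).2 = p.2 - r p.1 := rfl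
      linarith
    · rw [e]
      have : (shift T r p).2 = p.2 - r p.1 := rfl
      linarith
  unfold wrap
  congr 1
  apply Subtype.ext
  change ((T ^ _) _, _) = ((T ^ _) _, _)
  rw [← shift_zpow, ← shift_zpow, ← hi, zpow_add_one]
  rfl

theorem wrap_zpow (n : ℤ) (p : X × ℝ) : wrap T r ((shift T r ^ n) p) = wrap T r p := by
  induction n with
  | zero => simp
  | succ n ih =>
    rw [add_comm (n : ℤ) 1, zpow_one_add, ← ih]
    exact wrap_shift T r _
  | pred n ih =>
    rw [← ih, ← wrap_shift T r ((shift T r ^ (-(n : ℤ) - 1)) p)]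
    change wrap T r ((shift T r * shift T r ^ (-(n : ℤ) - 1)) p) = _
    rw [← zpow_one_add, add_sub_cancel]

theorem wrap_region (p : Region r) : wrap T r p.1 = mk T r p := by
  rcases p.2.2.lt_or_eq with h | h
  · have hi : index T r p.1.1 p.1.2 = 0 := by
      apply index_eq
      · simpa using p.2.1
      · rw [roofSum_add_one]; simpa using h
    unfold wrap
    congr 1
    apply Subtype.ext
    simp [hi]
  · rw [← wrap_shift]
    have hs : shift T r p.1 = (T p.1.1, 0) := by
      change (T p.1.1, p.1.2 - r p.1.1) = _
      rw [h, sub_self]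
    have hi : index T r (T p.1.1) 0 = 0 := by
      apply index_eq
      · simp
      · rw [roofSum_add_one, roofSum_zero, zero_add]; exact Set.mem_Ioi.1 (r _).2
    rw [hs]
    refine (Quot.sound ⟨h, ?_⟩).symm
    simp [hi]

theorem wrap_eq_wrap_iff (p q : X × ℝ) :
    wrap T r p = wrap T r q ↔ ∃ n : ℤ, (shift T r ^ n) p = q := by
  constructor
  · intro h
    let S : Setoid (X × ℝ) :=
      { r := fun p q => ∃ n : ℤ, (shift T r ^ n) p = q
        iseqv := ⟨fun p => ⟨0, by simp⟩, by
          rintro p q ⟨n, rfl⟩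
          refine ⟨-n, ?_⟩
          change (shift T r ^ (-n) * shift T r ^ n) p = p
          simp, by
          rintro p q s ⟨n, rfl⟩ ⟨m, rfl⟩
          exact ⟨m + n, by rw [zpow_add]; rfl⟩⟩ }
    let F : Space T r → Quotient S := Quot.lift (fun p => Quotient.mk S p.1) (by
      rintro a b ⟨h1, h2⟩
      refine Quotient.sound ⟨1, ?_⟩
      rw [zpow_one, h2]
      change (T a.1.1, a.1.2 - r a.1.1) = _
      rw [h1, sub_self])
    have hF : ∀ p, F (wrap T r p) = Quotient.mk S p := by
      intro p
      obtain ⟨n, a, ha, hw⟩ := wrap_eq_mk_zpow T r p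
      rw [hw]
      change Quotient.mk S a.1 = _
      have hpa : S p a.1 := ⟨n, ha.symm⟩
      exact (Quotient.sound hpa).symm
    exact Quotient.exact ((hF p).symm.trans ((congrArg F h).trans (hF q)))
  · rintro ⟨n, rfl⟩
    exact (wrap_zpow T r n p).symm

theorem locallyFinite_levels : LocallyFinite
    (fun n : ℤ => {p : X × ℝ | roofSum T r n p.1 ≤ p.2 ∧ p.2 ≤ roofSum T r (n + 1) p.1}) := by
  obtain ⟨c, hc, hr⟩ := exists_pos_le_roof r
  intro p
  have hopen : IsOpen {q : X × ℝ | |q.2| < |p.2| + 1} := isOpen_lt (by fun_prop) (by fun_prop)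
  refine ⟨{q | |q.2| < |p.2| + 1}, hopen.mem_nhds (by simp), ?_⟩
  obtain ⟨M, hM⟩ := exists_nat_gt ((|p.2| + 1) / c)
  have hM' : |p.2| + 1 < c * M := by rwa [div_lt_iff₀ hc, mul_comm] at hM
  refine (Set.finite_Icc (-(M : ℤ) - 1) M).subset ?_
  rintro n ⟨q, ⟨h1, h2⟩, h3⟩
  simp only [Set.mem_ofPred_eq] at h3
  have hq := abs_lt.1 h3
  constructor
  · by_contra! h
    have h4 := le_roofSum_sub T r hr (m := -M) (n := 0) (by omega) q.1
    have h5 := roofSum_mono T r (show n + 1 ≤ -M by omega) q.1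
    simp only [roofSum_zero, Int.cast_neg, Int.cast_natCast, Int.cast_zero] at h4
    linarith
  · by_contra! h
    have h4 := le_roofSum_sub T r hr (m := 0) (n := M) (by omega) q.1
    have h5 := roofSum_mono T r h.le q.1
    simp only [roofSum_zero, Int.cast_natCast, Int.cast_zero] at h4
    linarith

theorem continuous_wrap : Continuous (wrap T r) := by
  refine (locallyFinite_levels T r).continuous ?_ ?_ ?_
  · rw [Set.eq_univ_iff_forall]
    intro p
    have h := index_spec T r p.1 p.2
    exact Set.mem_iUnion.2 ⟨_, h.1, h.2.le⟩
  · intro n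
    have h1 := continuous_roofSum T r n
    have h2 := continuous_roofSum T r (n + 1)
    have h3 : IsClosed {p : X × ℝ | roofSum T r n p.1 ≤ p.2} :=
      isClosed_le (by fun_prop) (by fun_prop)
    have h4 : IsClosed {p : X × ℝ | p.2 ≤ roofSum T r (n + 1) p.1} :=
      isClosed_le (by fun_prop) (by fun_prop)
    exact h3.inter h4
  · intro n
    rw [continuousOn_iff_continuous_domRestrict]
    have hmem : ∀ p : {p : X × ℝ | roofSum T r n p.1 ≤ p.2 ∧ p.2 ≤ roofSum T r (n + 1) p.1},
        0 ≤ ((shift T r ^ n) p.1).2 ∧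
          ((shift T r ^ n) p.1).2 ≤ r ((shift T r ^ n) p.1).1 := by
      rintro ⟨p, h1, h2⟩
      rw [roofSum_add_one] at h2
      rw [shift_zpow]
      constructor
      · simp only; linarith
      · simp only; linarith
    have heq : Set.domRestrict _ (wrap T r) = fun p => mk T r ⟨(shift T r ^ n) p.1, hmem p⟩ := by
      funext p
      rw [← wrap_region, wrap_zpow]
      rfl
    rw [heq]
    exact (continuous_mk T r).comp (by fun_prop)

theorem isOpenQuotientMap_wrap : IsOpenQuotientMap (wrap T r) where
  surjective q := by
    obtain ⟨p, rfl⟩ := Quot.exists_rep q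
    exact ⟨p.1, wrap_region T r p⟩
  continuous := continuous_wrap T r
  isOpenMap U hU := by
    have h1 : wrap T r ⁻¹' (wrap T r '' U) = ⋃ n : ℤ, (shift T r ^ n) ⁻¹' U := by
      ext p
      simp only [Set.mem_preimage, Set.mem_image, Set.mem_iUnion]
      constructor
      · rintro ⟨q, hq, h⟩
        obtain ⟨n, rfl⟩ := (wrap_eq_wrap_iff T r p q).1 h.symm
        exact ⟨n, hq⟩
      · rintro ⟨n, hn⟩
        exact ⟨_, hn, wrap_zpow T r n p⟩
    have h2 : IsOpen (wrap T r ⁻¹' (wrap T r '' U)) := by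
      rw [h1]
      exact isOpen_iUnion fun n => hU.preimage (shift T r ^ n).continuous
    have h3 : mk T r ⁻¹' (wrap T r '' U) =
        (Subtype.val : Region r → X × ℝ) ⁻¹' (wrap T r ⁻¹' (wrap T r '' U)) := by
      ext p
      simp only [Set.mem_preimage, wrap_region]
    have h4 : Topology.IsQuotientMap (mk T r) := isQuotientMap_quot_mk
    rw [← h4.isOpen_preimage, h3]
    exact h2.preimage continuous_subtype_val

instance : CompactSpace (Space T r) := by
  have hK : IsCompact {p : X × ℝ | 0 ≤ p.2 ∧ p.2 ≤ r p.1} := by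
    obtain ⟨b, hb⟩ := (isCompact_univ.image_of_continuousOn
      (f := fun x => (r x : ℝ)) (by fun_prop)).bddAbove
    have h3 : IsClosed {p : X × ℝ | 0 ≤ p.2} := isClosed_le (by fun_prop) (by fun_prop)
    have h4 : IsClosed {p : X × ℝ | p.2 ≤ r p.1} := isClosed_le (by fun_prop) (by fun_prop)
    refine (isCompact_univ.prod (isCompact_Icc (a := (0 : ℝ)) (b := b))).of_isClosed_subset
      (h3.inter h4) ?_
    rintro p ⟨h1, h2⟩
    exact ⟨Set.mem_univ _, h1, h2.trans (hb ⟨p.1, Set.mem_univ _, rfl⟩)⟩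
  have : CompactSpace (Region r) := isCompact_iff_compactSpace.1 hK
  exact inferInstanceAs (CompactSpace (Quot (Glue T r)))

instance [T2Space X] : T2Space (Space T r) := by
  rw [t2Space_iff_of_isOpenQuotientMap (isOpenQuotientMap_wrap T r)]
  have h : {q : (X × ℝ) × (X × ℝ) | wrap T r q.1 = wrap T r q.2} =
      ⋃ n : ℤ, {q : (X × ℝ) × (X × ℝ) | (shift T r ^ n) q.1 = q.2} := by
    ext q
    simp [wrap_eq_wrap_iff]
  rw [h]
  refine LocallyFinite.isClosed_iUnion ?_ fun n => isClosed_eq (by fun_prop) (by fun_prop)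
  obtain ⟨c, hc, hr⟩ := exists_pos_le_roof r
  intro p
  set B := |p.1.2| + |p.2.2| + 2
  have hopen : IsOpen {q : (X × ℝ) × (X × ℝ) | |q.1.2| + |q.2.2| < B} :=
    isOpen_lt (by fun_prop) (by fun_prop)
  refine ⟨{q | |q.1.2| + |q.2.2| < B}, hopen.mem_nhds (by simp [B]), ?_⟩
  obtain ⟨M, hM⟩ := exists_nat_gt (B / c)
  have hM' : B < c * M := by rwa [div_lt_iff₀ hc, mul_comm] at hM
  refine (Set.finite_Icc (-(M : ℤ)) M).subset ?_
  rintro n ⟨q, h1, h3⟩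
  simp only [Set.mem_ofPred_eq] at h1 h3
  rw [shift_zpow] at h1
  have h2 : q.1.2 - roofSum T r n q.1.1 = q.2.2 := congrArg Prod.snd h1
  have a1 := neg_abs_le q.1.2
  have a2 := le_abs_self q.1.2
  have a3 := neg_abs_le q.2.2
  have a4 := le_abs_self q.2.2
  constructor
  · by_contra! h
    have h4 := le_roofSum_sub T r hr (m := -M) (n := 0) (by omega) q.1.1
    have h5 := roofSum_mono T r h.le q.1.1
    simp only [roofSum_zero, Int.cast_neg, Int.cast_natCast, Int.cast_zero] at h4
    linarith
  · by_contra! h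
    have h4 := le_roofSum_sub T r hr (m := 0) (n := M) (by omega) q.1.1
    have h5 := roofSum_mono T r h.le q.1.1
    simp only [roofSum_zero, Int.cast_natCast, Int.cast_zero] at h4
    linarith

instance [T2Space X] [SecondCountableTopology X] :
    TopologicalSpace.MetrizableSpace (Space T r) := by
  have h := isOpenQuotientMap_wrap T r
  have : SecondCountableTopology (Space T r) :=
    h.isQuotientMap.secondCountableTopology h.isOpenMap
  infer_instance

/-- The map `φ_t(x, s) = (T^n x, s + t - r_n(x))` of `X_r`, where `n` is the unique integer with
`r_n(x) ≤ s + t < r_(n+1)(x)`. -/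
noncomputable def flowMap (t : ℝ) : Space T r → Space T r :=
  Quot.lift (fun p : Region r => wrap T r (p.1.1, p.1.2 + t)) (by
    rintro p q ⟨h1, h2⟩
    rw [← wrap_shift]
    change wrap T r (T p.1.1, p.1.2 + t - r p.1.1) = _
    simp [h2, h1])

theorem flowMap_wrap (t : ℝ) (p : X × ℝ) :
    flowMap T r t (wrap T r p) = wrap T r (p.1, p.2 + t) := by
  obtain ⟨n, a, ha, hw⟩ := wrap_eq_mk_zpow T r p
  rw [hw]
  change wrap T r (a.1.1, a.1.2 + t) = _
  rw [← wrap_zpow T r n (p.1, p.2 + t), shift_zpow, ha, shift_zpow]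
  congr 2
  ring

/-- The suspension flow `(φ_t)` on `X_r`. -/
noncomputable def flow : Flow ℝ (Space T r) where
  toFun := flowMap T r
  cont' := by
    rw [← (IsOpenQuotientMap.id.prodMap (isOpenQuotientMap_wrap T r)).continuous_comp_iff]
    have h : Continuous fun z : ℝ × (X × ℝ) => wrap T r (z.2.1, z.2.2 + z.1) :=
      (continuous_wrap T r).comp (by fun_prop)
    exact h.congr fun z => (flowMap_wrap T r z.1 z.2).symm
  map_add' s t q := by
    obtain ⟨p, rfl⟩ := (isOpenQuotientMap_wrap T r).surjective q
    rw [flowMap_wrap, flowMap_wrap, flowMap_wrap, add_comm s t, add_assoc]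
  map_zero' q := by
    obtain ⟨p, rfl⟩ := (isOpenQuotientMap_wrap T r).surjective q
    rw [flowMap_wrap, add_zero]

/-- The time-one map `φ_1` of the suspension flow, a homeomorphism of `X_r`. -/
noncomputable def timeOne : Space T r ≃ₜ Space T r := (flow T r).toHomeomorph 1

end

end Suspension

/-! # Entropy, ergodic measures and spectrum -/

/-- The topological entropy of a self-map of a compact Hausdorff space: the Bowen--Dinaburg entropy
with respect to the only uniform structure inducing the topology (for a compact metric space, the
one of the metric). -/
noncomputable def topologicalEntropy {X : Type*} [TopologicalSpace X] [CompactSpace X] [T2Space X]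
    (T : X → X) : EReal :=
  letI : UniformSpace X := uniformSpaceOfCompactR1
  Dynamics.coverEntropy T Set.univ

theorem topologicalEntropy_eq {X : Type*} [UniformSpace X] [CompactSpace X] [T2Space X]
    (T : X → X) : topologicalEntropy T = Dynamics.coverEntropy T Set.univ := by
  unfold topologicalEntropy
  congr 1
  exact unique_uniformity_of_compact rfl rfl

/-- The set of `T`-invariant Borel probability measures. -/
def invariantMeasures {X : Type*} [MeasurableSpace X] (T : X → X) :
    Set (MeasureTheory.Measure X) :=
  {μ | MeasureTheory.IsProbabilityMeasure μ ∧ MeasureTheory.MeasurePreserving T μ μ}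

/-- The set of ergodic `T`-invariant Borel probability measures. As a subtype of the space of
measures it carries the `σ`-algebra generated by the evaluations `m ↦ m A`, which on a compact
metric space is the Borel `σ`-algebra of the weak-* topology. -/
def ergodicMeasures {X : Type*} [MeasurableSpace X] (T : X → X) :
    Set (MeasureTheory.Measure X) :=
  {m | MeasureTheory.IsProbabilityMeasure m ∧ Ergodic T m}

/-- The spectrum of the system `(X, m, T)`: all `z` on the unit circle that are eigenvalues of the
Koopman operator `f ↦ f ∘ T` on `L²(m)`. -/
def koopmanSpectrum {X : Type*} [MeasurableSpace X] (T : X → X) (m : MeasureTheory.Measure X) :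
    Set Circle :=
  {z | ∃ f : X → ℂ, MeasureTheory.MemLp f 2 m ∧ ¬ f =ᵐ[m] 0 ∧
    f ∘ T =ᵐ[m] fun x => (z : ℂ) * f x}

/-- `τ` is the ergodic decomposition of `μ`: a probability measure on the space of ergodic measures
with `μ = ∫ m dτ(m)`. -/
def IsErgodicDecomposition {X : Type*} [MeasurableSpace X] (T : X → X)
    (μ : MeasureTheory.Measure X) (τ : MeasureTheory.Measure (ergodicMeasures T)) : Prop :=
  MeasureTheory.IsProbabilityMeasure τ ∧
    ∀ A : Set X, MeasurableSet A → μ A = ∫⁻ m, m.1 A ∂τ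

/-- The invariant measure `μ` has almost countable spectrum: some countable set contains the
spectrum of almost every ergodic component of `μ`. (By the ergodic decomposition theorem `μ` has
exactly one ergodic decomposition `τ`.) -/
def HasAlmostCountableSpectrum {X : Type*} [MeasurableSpace X] (T : X → X)
    (μ : MeasureTheory.Measure X) : Prop :=
  ∃ C : Set Circle, C.Countable ∧
    ∀ τ : MeasureTheory.Measure (ergodicMeasures T), IsErgodicDecomposition T μ τ →
      ∀ᵐ m ∂τ, koopmanSpectrum T m.1 ⊆ C

open Set Filter Topology Uniformity MeasureTheory

/-! The space `Space T r` is the quotient of X × ℝ by `shift`, and the flow is vertical translation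
upstairs.

Spectrum: a φ₁-invariant measure m lifts to a measure on X × ℝ invariant under the shift and under
translation by 1. Averaging over translations by t ∈ [0, 1) smooths the lift into ν × Lebesgue,
where ν is `baseMeasure T r m` (`lintegral_baseMeasure`). This ν is finite, nonzero and T-invariant,
and ergodic if m is. So the averages ∫₀¹ (φ_t)_* m dt of ergodic m are normalised suspensions of
ergodic measures of T, and they form a countable set (`countable_flowAverage`). Eigenvalues for m
are eigenvalues for its average (`koopmanSpectrum_subset_flowAverage`): otherwise the mean ergodic
theorem sends the twisted averages of a continuous g to 0 in L² of the average, which forces an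
eigenfunction in L²(m) to be orthogonal to g ∘ φ_t for t ∈ [0, 1). Each average has countably many
eigenvalues because L² is separable (`countable_koopmanSpectrum`).

Entropy: dynamical balls are counted directly. A point (x, s) is coded by a dynamical ball
containing x, the rounded growth of the roof sums over blocks of length L, and the rounded height s.
Equal codes give close φ₁-orbits. Each block has M possible values with M linear in L, so the roof
adds a rate of only (log M)/L per base step, which is small for large L (`coverMincard_timeOne_le`).
-/

namespace Suspension

/-! ### Lifting measures to X × ℝ and averaging along the flow. -/

section Measures

set_option linter.unusedSectionVars false

variable {X : Type*} [MetricSpace X] [CompactSpace X]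
variable (T : X ≃ₜ X) (r : C(X, Set.Ioi (0 : ℝ)))

/-- The representative `(T^n x, s - r_n(x))` of the shift orbit of `(x, s)` which lies in
`{(x, s) : 0 ≤ s < r x}`. -/
noncomputable def normalForm (p : X × ℝ) : X × ℝ := (shift T r ^ index T r p.1 p.2) p

/-- The fundamental domain `{(x, s) : 0 ≤ s < r x}` of the shift. -/
def domain : Set (X × ℝ) := {p | 0 ≤ p.2 ∧ p.2 < r p.1}

theorem normalForm_mem_domain (p : X × ℝ) : normalForm T r p ∈ domain r := by
  have h := index_spec T r p.1 p.2
  rw [roofSum_add_one] at h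
  rw [normalForm, shift_zpow]
  constructor
  · simp only; linarith
  · simp only; linarith

/-- Uniqueness of the index makes `domain r` a strict fundamental domain: each shift orbit meets it
exactly once. -/
theorem zpow_mem_domain_iff (n : ℤ) (p : X × ℝ) :
    (shift T r ^ n) p ∈ domain r ↔ n = index T r p.1 p.2 := by
  constructor
  · rintro ⟨h1, h2⟩
    rw [shift_zpow] at h1 h2
    refine (index_eq T r ?_ ?_).symm
    · simp only at h1; linarith
    · rw [roofSum_add_one]; simp only at h2; linarith
  · rintro rfl
    exact normalForm_mem_domain T r p

theorem zpow_shift_zpow (m n : ℤ) (p : X × ℝ) :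
    (shift T r ^ m) ((shift T r ^ n) p) = (shift T r ^ (m + n)) p := by
  rw [zpow_add]; rfl

theorem wrap_normalForm (p : X × ℝ) : wrap T r (normalForm T r p) = wrap T r p :=
  wrap_zpow T r _ p

theorem normalForm_eq_of_wrap_eq {p q : X × ℝ} (h : wrap T r p = wrap T r q) :
    normalForm T r p = normalForm T r q := by
  obtain ⟨n, hn⟩ := (wrap_eq_wrap_iff T r p q).1 h
  have h1 := normalForm_mem_domain T r q
  rw [normalForm, ← hn, zpow_shift_zpow, zpow_mem_domain_iff] at h1
  rw [normalForm, normalForm, ← hn, zpow_shift_zpow, h1]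

/-- The section of `wrap` with values in `{(x, s) : 0 ≤ s < r x}`. -/
noncomputable def lower (q : Space T r) : X × ℝ :=
  normalForm T r (Function.surjInv (isOpenQuotientMap_wrap T r).surjective q)

theorem lower_wrap (p : X × ℝ) : lower T r (wrap T r p) = normalForm T r p :=
  normalForm_eq_of_wrap_eq T r (Function.surjInv_eq _ _)

theorem lower_mem_domain (q : Space T r) : lower T r q ∈ domain r := normalForm_mem_domain T r _

theorem wrap_lower (q : Space T r) : wrap T r (lower T r q) = q := by
  rw [lower, wrap_normalForm]
  exact Function.surjInv_eq _ q

/-- The sum of a function over the shift orbit that represents a point of `X_r`. -/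
noncomputable def orbitSum (f : X × ℝ → ENNReal) (q : Space T r) : ENNReal :=
  ∑' n : ℤ, f ((shift T r ^ n) (lower T r q))

theorem orbitSum_wrap (f : X × ℝ → ENNReal) (p : X × ℝ) :
    orbitSum T r f (wrap T r p) = ∑' n : ℤ, f ((shift T r ^ n) p) := by
  simp only [orbitSum, lower_wrap, normalForm, zpow_shift_zpow]
  exact (Equiv.addRight (index T r p.1 p.2)).tsum_eq fun n => f ((shift T r ^ n) p)

theorem orbitSum_comp_shift (f : X × ℝ → ENNReal) :
    orbitSum T r (fun p => f (shift T r p)) = orbitSum T r f := by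
  funext q
  simp only [orbitSum]
  rw [← (Equiv.addLeft (1 : ℤ)).tsum_eq fun n => f ((shift T r ^ n) (lower T r q))]
  refine tsum_congr fun n => ?_
  change _ = f ((shift T r ^ (1 + n)) _)
  rw [zpow_one_add]
  rfl

/-- Only one point of each orbit lies in the domain, so one summand survives. Integrals over X_r
thus become integrals upstairs. -/
theorem orbitSum_indicator (h : Space T r → ENNReal) :
    orbitSum T r ((domain r).indicator fun p => h (wrap T r p)) = h := by
  funext q
  obtain ⟨p, rfl⟩ := (isOpenQuotientMap_wrap T r).surjective q
  rw [orbitSum_wrap, tsum_eq_single (index T r p.1 p.2)]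
  · rw [indicator_of_mem ((zpow_mem_domain_iff T r _ p).2 rfl), wrap_zpow]
  · intro n hn
    exact indicator_of_notMem (fun h => hn ((zpow_mem_domain_iff T r n p).1 h)) _

theorem zpow_translate (n : ℤ) (p : X × ℝ) (t : ℝ) :
    (shift T r ^ n) (p.1, p.2 + t) =
      (((shift T r ^ n) p).1, ((shift T r ^ n) p).2 + t) := by
  simp only [shift_zpow]
  congr 1
  ring

/-- Vertical translation commutes with the shift and descends to the flow. -/
theorem orbitSum_comp_translate (f : X × ℝ → ENNReal) (t : ℝ) (q : Space T r) :
    orbitSum T r (fun p => f (p.1, p.2 + t)) q = orbitSum T r f (flowMap T r t q) := by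
  obtain ⟨p, rfl⟩ := (isOpenQuotientMap_wrap T r).surjective q
  rw [flowMap_wrap, orbitSum_wrap, orbitSum_wrap]
  simp only [zpow_translate]

variable [MeasurableSpace X] [BorelSpace X]

theorem measurable_index : Measurable fun p : X × ℝ => index T r p.1 p.2 := by
  refine measurable_to_countable' fun n => ?_
  have h : (fun p : X × ℝ => index T r p.1 p.2) ⁻¹' {n} =
      {p | roofSum T r n p.1 ≤ p.2} ∩ {p | p.2 < roofSum T r (n + 1) p.1} := by
    ext p
    simp only [mem_preimage, mem_singleton_iff, mem_inter_iff, mem_ofPred_eq]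
    refine ⟨?_, fun h => index_eq T r h.1 h.2⟩
    rintro rfl
    exact index_spec T r p.1 p.2
  have h1 := continuous_roofSum T r n
  have h2 := continuous_roofSum T r (n + 1)
  rw [h]
  exact (isClosed_le (by fun_prop) (by fun_prop)).measurableSet.inter
    (isOpen_lt (by fun_prop) (by fun_prop)).measurableSet

theorem measurable_normalForm : Measurable (normalForm T r) := by
  have h : Measurable fun z : (X × ℝ) × ℤ => (shift T r ^ z.2) z.1 :=
    measurable_from_prod_countable_left fun n => (shift T r ^ n).continuous.measurable
  exact h.comp (measurable_id.prodMk (measurable_index T r))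

theorem measurable_wrap : Measurable (wrap T r) := (continuous_wrap T r).measurable

theorem measurable_lower : Measurable (lower T r) := by
  -- A Borel surjection from a standard Borel space detects measurability, so it is enough to treat
  -- the composition with `wrap`.
  rw [← (measurable_wrap T r).measurable_comp_iff_of_surjective
    (isOpenQuotientMap_wrap T r).surjective]
  have h : lower T r ∘ wrap T r = normalForm T r := funext (lower_wrap T r)
  rw [h]
  exact measurable_normalForm T r

theorem measurableSet_domain : MeasurableSet (domain r : Set (X × ℝ)) :=
  (isClosed_le (f := fun _ : X × ℝ => (0 : ℝ)) (g := fun p => p.2) (by fun_prop)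
    (by fun_prop)).measurableSet.inter
    (isOpen_lt (f := fun p : X × ℝ => p.2) (g := fun p => (r p.1 : ℝ)) (by fun_prop)
      (by fun_prop)).measurableSet

theorem measurable_zpow_lower (n : ℤ) :
    Measurable fun q => (shift T r ^ n) (lower T r q) :=
  (shift T r ^ n).continuous.measurable.comp (measurable_lower T r)

theorem measurable_orbitSum {f : X × ℝ → ENNReal} (hf : Measurable f) :
    Measurable (orbitSum T r f) :=
  Measurable.tsum fun n => hf.comp (measurable_zpow_lower T r n)

theorem continuous_flowMap_uncurry :
    Continuous fun z : Space T r × ℝ => flowMap T r z.2 z.1 :=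
  (flow T r).continuous continuous_snd continuous_fst

theorem continuous_flowMap (t : ℝ) : Continuous (flowMap T r t) :=
  (flow T r).continuous continuous_const continuous_id

/-- The lift of a measure on `X_r` to a shift-invariant measure on `X × ℝ`. -/
noncomputable def lift (m : Measure (Space T r)) : Measure (X × ℝ) :=
  Measure.sum fun n : ℤ => m.map fun q => (shift T r ^ n) (lower T r q)

instance (m : Measure (Space T r)) [IsFiniteMeasure m] : SFinite (lift T r m) := by
  unfold lift; infer_instance

theorem lintegral_lift (m : Measure (Space T r)) {f : X × ℝ → ENNReal} (hf : Measurable f) :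
    ∫⁻ p, f p ∂lift T r m = ∫⁻ q, orbitSum T r f q ∂m := by
  rw [lift, lintegral_sum_measure]
  simp only [orbitSum]
  rw [lintegral_tsum (f := fun n q => f ((shift T r ^ n) (lower T r q)))
    fun n => (hf.comp (measurable_zpow_lower T r n)).aemeasurable]
  exact tsum_congr fun n => lintegral_map hf (measurable_zpow_lower T r n)

theorem lintegral_lift_translate (m : Measure (Space T r)) {f : X × ℝ → ENNReal}
    (hf : Measurable f) (t : ℝ) :
    ∫⁻ p, f (p.1, p.2 + t) ∂lift T r m = ∫⁻ q, orbitSum T r f (flowMap T r t q) ∂m := by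
  rw [lintegral_lift T r m (f := fun p => f (p.1, p.2 + t)) (hf.comp (by fun_prop))]
  exact lintegral_congr fun q => orbitSum_comp_translate T r f t q

/-- Translation by 1 upstairs is the time-one map downstairs; `key` applied to translates of f then
gives all integers, of both signs. -/
theorem lintegral_lift_translate_intCast {m : Measure (Space T r)}
    (hm : MeasurePreserving (timeOne T r) m m) (j : ℤ) :
    ∀ {f : X × ℝ → ENNReal}, Measurable f →
      ∫⁻ p, f (p.1, p.2 + j) ∂lift T r m = ∫⁻ p, f p ∂lift T r m := by
  have key : ∀ {f : X × ℝ → ENNReal}, Measurable f →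
      ∫⁻ p, f (p.1, p.2 + 1) ∂lift T r m = ∫⁻ p, f p ∂lift T r m := by
    intro f hf
    rw [lintegral_lift_translate T r m hf, lintegral_lift T r m hf]
    exact hm.lintegral_comp (measurable_orbitSum T r hf)
  induction j with
  | zero => intro f _; simp
  | succ n ih =>
    intro f hf
    rw [← ih hf, ← key (f := fun p => f (p.1, p.2 + (n : ℤ))) (hf.comp (by fun_prop))]
    refine lintegral_congr fun p => ?_
    push_cast
    ring_nf
  | pred n ih =>
    intro f hf
    rw [← ih hf, ← key (f := fun p => f (p.1, p.2 + ((-n - 1 : ℤ) : ℝ))) (hf.comp (by fun_prop))]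
    refine lintegral_congr fun p => ?_
    push_cast
    ring_nf

/-- The measure on the base `X` that corresponds to a measure on `X_r` invariant under the time-one
map: the lift of the measure, restricted to `X × [0, 1)` and projected to `X`. -/
noncomputable def baseMeasure (m : Measure (Space T r)) : Measure X :=
  ((lift T r m).restrict (Prod.snd ⁻¹' Ico 0 1)).map Prod.fst

/-- The average `∫₀¹ (φ_t)_* m dt`. -/
noncomputable def flowAverage (m : Measure (Space T r)) : Measure (Space T r) :=
  (m.prod (volume.restrict (Ico (0 : ℝ) 1))).map fun z => flowMap T r z.2 z.1

theorem lintegral_flowAverage (m : Measure (Space T r)) [SFinite m] {h : Space T r → ENNReal}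
    (hh : Measurable h) :
    ∫⁻ q, h q ∂flowAverage T r m = ∫⁻ t in Ico (0 : ℝ) 1, ∫⁻ q, h (flowMap T r t q) ∂m := by
  have hmeas := (continuous_flowMap_uncurry T r).measurable
  rw [flowAverage, lintegral_map hh hmeas, lintegral_prod_symm]
  exact (hh.comp hmeas).aemeasurable

theorem tsum_lintegral_Ico (g : ℝ → ENNReal) (s : ℝ) :
    ∑' j : ℤ, ∫⁻ t in Ico (0 : ℝ) 1, g (s + j + t) = ∫⁻ t, g t := by
  rw [← lintegral_add_left_eq_self g s, ← setLIntegral_univ, ← iUnion_Ico_intCast ℝ,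
    lintegral_iUnion (fun _ => measurableSet_Ico) (pairwise_disjoint_Ico_intCast ℝ)]
  refine tsum_congr fun j => ?_
  rw [← lintegral_indicator measurableSet_Ico, ← lintegral_indicator measurableSet_Ico,
    ← lintegral_add_left_eq_self ((Ico (j : ℝ) (j + 1)).indicator _) (j : ℝ)]
  refine lintegral_congr fun t => ?_
  have : (j : ℝ) + t ∈ Ico (j : ℝ) (j + 1) ↔ t ∈ Ico (0 : ℝ) 1 := by
    simp only [mem_Ico]
    constructor <;> rintro ⟨h1, h2⟩ <;> constructor <;> linarith
  by_cases ht : t ∈ Ico (0 : ℝ) 1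
  · rw [indicator_of_mem ht, indicator_of_mem (this.2 ht), add_assoc]
  · rw [indicator_of_notMem ht, indicator_of_notMem (mt this.1 ht)]

/-- The right side is the integral of f against the lift of the average, so the lift is ν ×
Lebesgue. With k the integral of f over a vertical unit window, the strips X × [j, j + 1) are all
moved to X × [0, 1) by integer translations. -/
theorem lintegral_baseMeasure {m : Measure (Space T r)} [IsFiniteMeasure m]
    (hm : MeasurePreserving (timeOne T r) m m) {f : X × ℝ → ENNReal} (hf : Measurable f) :
    ∫⁻ x, ∫⁻ t : ℝ, f (x, t) ∂volume ∂baseMeasure T r m = ∫⁻ q, orbitSum T r f q ∂flowAverage T r m := by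
  have hmeas : ∀ s : Set ℝ, Measurable fun p : X × ℝ => ∫⁻ t in s, f (p.1, p.2 + t) := by
    intro s
    exact Measurable.lintegral_prod_right' (f := fun z : (X × ℝ) × ℝ => f (z.1.1, z.1.2 + z.2))
      (hf.comp (by fun_prop))
  set S : Set (X × ℝ) := Prod.snd ⁻¹' Ico 0 1
  have hS : MeasurableSet S := measurable_snd measurableSet_Ico
  set k : X × ℝ → ENNReal := fun p => ∫⁻ t in Ico (0 : ℝ) 1, f (p.1, p.2 + t)
  have hk : Measurable k := hmeas _
  have hone : ∀ p : X × ℝ, k p = ∑' j : ℤ, (Prod.snd ⁻¹' Ico (j : ℝ) (j + 1)).indicator k p := by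
    intro p
    rw [tsum_eq_single ⌊p.2⌋, indicator_of_mem]
    · exact ⟨Int.floor_le _, Int.lt_floor_add_one _⟩
    · intro j hj
      refine indicator_of_notMem (fun h => hj ?_) _
      exact (Int.floor_eq_iff.2 h).symm
  rw [lintegral_flowAverage T r m (measurable_orbitSum T r hf)]
  simp_rw [← lintegral_lift_translate T r m hf]
  rw [lintegral_lintegral_swap (f := fun (t : ℝ) (p : X × ℝ) => f (p.1, p.2 + t))
    (hf.comp (g := f) (f := fun z : ℝ × (X × ℝ) => (z.2.1, z.2.2 + z.1)) (by fun_prop)).aemeasurable]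
  change _ = ∫⁻ p, k p ∂lift T r m
  simp_rw [hone]
  rw [lintegral_tsum fun j => (hk.indicator (measurable_snd measurableSet_Ico)).aemeasurable]
  have hterm : ∀ j : ℤ, ∫⁻ p, (Prod.snd ⁻¹' Ico (j : ℝ) (j + 1)).indicator k p ∂lift T r m =
      ∫⁻ p, S.indicator (fun p => k (p.1, p.2 + j)) p ∂lift T r m := by
    intro j
    rw [← lintegral_lift_translate_intCast T r hm j
      (hk.indicator (measurable_snd measurableSet_Ico))]
    refine lintegral_congr fun p => ?_
    have : (p.1, p.2 + j) ∈ (Prod.snd ⁻¹' Ico (j : ℝ) (j + 1) : Set (X × ℝ)) ↔ p ∈ S := by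
      simp only [S, mem_preimage, mem_Ico]
      constructor <;> rintro ⟨h1, h2⟩ <;> constructor <;> linarith
    by_cases hp : p ∈ S
    · rw [indicator_of_mem hp, indicator_of_mem (this.2 hp)]
    · rw [indicator_of_notMem hp, indicator_of_notMem (mt this.1 hp)]
  simp_rw [hterm, lintegral_indicator hS]
  rw [← lintegral_tsum (f := fun (j : ℤ) (p : X × ℝ) => k (p.1, p.2 + j))
    fun j => (hk.comp (by fun_prop)).aemeasurable, baseMeasure,
    lintegral_map (Measurable.lintegral_prod_right' hf) measurable_fst]
  refine lintegral_congr fun p => ?_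
  -- The windows starting at the heights p.2 + j tile the line, so the sum depends on p.1 only.
  rw [← tsum_lintegral_Ico (fun t => f (p.1, t)) p.2]

/-- Test on the indicator of the domain, whose fibre over x has length r x. As r is bounded below by
a positive constant, this makes the base measure finite and nonzero. -/
theorem lintegral_roof_baseMeasure {m : Measure (Space T r)} [IsFiniteMeasure m]
    (hm : MeasurePreserving (timeOne T r) m m) :
    ∫⁻ x, ENNReal.ofReal (r x) ∂baseMeasure T r m = flowAverage T r m univ := by
  have h := lintegral_baseMeasure T r hm
    (f := (domain r).indicator fun p => (fun _ => 1 : Space T r → ENNReal) (wrap T r p))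
    (measurable_const.indicator (measurableSet_domain r))
  rw [orbitSum_indicator T r fun _ => 1, lintegral_one] at h
  rw [← h]
  refine lintegral_congr fun x => ?_
  have hx : ∀ t, (domain r).indicator (fun _ => (1 : ENNReal)) (x, t) =
      (Ico 0 (r x : ℝ)).indicator (fun _ => 1) t := fun t => rfl
  simp_rw [hx]
  rw [lintegral_indicator measurableSet_Ico]
  simp

instance (m : Measure (Space T r)) [IsProbabilityMeasure m] :
    IsProbabilityMeasure (flowAverage T r m) := by
  have : IsProbabilityMeasure (volume.restrict (Ico (0 : ℝ) 1)) := ⟨by simp⟩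
  exact Measure.isProbabilityMeasure_map (continuous_flowMap_uncurry T r).measurable.aemeasurable

theorem isFiniteMeasure_baseMeasure {m : Measure (Space T r)} [IsProbabilityMeasure m]
    (hm : MeasurePreserving (timeOne T r) m m) : IsFiniteMeasure (baseMeasure T r m) := by
  obtain ⟨c, hc, hr⟩ := exists_pos_le_roof r
  refine ⟨?_⟩
  by_contra! htop
  have h := lintegral_roof_baseMeasure T r hm
  rw [measure_univ] at h
  have h1 : ∫⁻ _, ENNReal.ofReal c ∂baseMeasure T r m ≤ 1 := by
    rw [← h]
    exact lintegral_mono fun x => ENNReal.ofReal_le_ofReal (hr x)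
  rw [lintegral_const, top_le_iff.1 htop, ENNReal.mul_top (by simpa using hc)] at h1
  simp at h1

theorem baseMeasure_ne_zero {m : Measure (Space T r)} [IsProbabilityMeasure m]
    (hm : MeasurePreserving (timeOne T r) m m) : baseMeasure T r m ≠ 0 := by
  intro h0
  have h := lintegral_roof_baseMeasure T r hm
  simp [h0] at h

/-- Test on f(x, t) = g(x) for t ∈ [0, 1) and 0 elsewhere. Composing f with the shift keeps its
orbit sum and turns g into g ∘ T. -/
theorem measurePreserving_baseMeasure {m : Measure (Space T r)} [IsFiniteMeasure m]
    (hm : MeasurePreserving (timeOne T r) m m) :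
    MeasurePreserving T (baseMeasure T r m) (baseMeasure T r m) := by
  refine ⟨T.continuous.measurable, Measure.ext_of_lintegral _ fun g hg => ?_⟩
  rw [lintegral_map hg T.continuous.measurable]
  set f : X × ℝ → ENNReal := fun p => (Ico (0 : ℝ) 1).indicator (fun _ => g p.1) p.2
  have hf : Measurable f := by
    have : f = (Prod.snd ⁻¹' Ico (0 : ℝ) 1).indicator fun p => g p.1 := rfl
    rw [this]
    exact (hg.comp measurable_fst).indicator (measurable_snd measurableSet_Ico)
  have h1 := lintegral_baseMeasure T r hm hf
  have h2 := lintegral_baseMeasure T r hm (hf.comp (shift T r).continuous.measurable)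
  rw [show (f ∘ shift T r) = fun p => f (shift T r p) from rfl, orbitSum_comp_shift, ← h1] at h2
  have hfx : ∀ x, ∫⁻ t, f (x, t) = g x := by
    intro x
    simp only [f]
    rw [lintegral_indicator measurableSet_Ico]
    simp
  have hsx : ∀ x, ∫⁻ t, f (shift T r (x, t)) = g (T x) := by
    intro x
    rw [← hfx (T x)]
    exact lintegral_sub_right_eq_self (fun t => f (T x, t)) (r x : ℝ)
  simpa only [hfx, hsx] using h2

/-- A T-invariant set A defines a flow-invariant subset of X_r, since the shift moves base points
along T-orbits. -/
theorem fst_lower_mem_iff {A : Set X} (hA : T ⁻¹' A = A) (p : X × ℝ) :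
    (lower T r (wrap T r p)).1 ∈ A ↔ p.1 ∈ A := by
  have h : ∀ n : ℤ, ∀ x, (T ^ n) x ∈ A ↔ x ∈ A := by
    have hT : ∀ x, T x ∈ A ↔ x ∈ A := fun x => by
      conv_rhs => rw [← hA]
      rfl
    intro n
    induction n with
    | zero => intro x; simp
    | succ n ih =>
      intro x
      rw [zpow_add_one, ← hT x]
      exact ih (T x)
    | pred n ih =>
      intro x
      rw [← ih x, ← hT, show T ((T ^ (-(n : ℤ) - 1)) x) = (T * T ^ (-(n : ℤ) - 1)) x from rfl,
        ← zpow_one_add, add_sub_cancel]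
  rw [lower_wrap, normalForm, shift_zpow]
  exact h _ _

/-- The strip over A lies in A × ℝ, whose lifted mass integrates an orbit sum that vanishes off the
null set. -/
theorem baseMeasure_le {m : Measure (Space T r)} {A : Set X} (hA : MeasurableSet A)
    (hinv : T ⁻¹' A = A) (h0 : m {q | (lower T r q).1 ∈ A} = 0) : baseMeasure T r m A = 0 := by
  rw [baseMeasure, Measure.map_apply measurable_fst hA]
  refine le_antisymm ((Measure.restrict_apply_le _ _).trans ?_) zero_le
  rw [← lintegral_indicator_one (measurable_fst hA),
    lintegral_lift T r m (measurable_one.indicator (measurable_fst hA))]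
  have : ∀ᵐ q ∂m, orbitSum T r ((Prod.fst ⁻¹' A).indicator 1) q = 0 := by
    have h1 : ∀ᵐ q ∂m, ¬ (lower T r q).1 ∈ A := by
      rw [ae_iff]
      simpa using h0
    filter_upwards [h1] with q hq
    rw [orbitSum, ENNReal.tsum_eq_zero]
    intro n
    refine indicator_of_notMem (fun h => hq ?_) _
    have h2 := (fst_lower_mem_iff T r hinv ((shift T r ^ n) (lower T r q))).2 h
    rwa [wrap_zpow, wrap_lower] at h2
  rw [lintegral_congr_ae this, lintegral_zero]

theorem preErgodic_baseMeasure {m : Measure (Space T r)} (hm : Ergodic (timeOne T r) m) :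
    PreErgodic T (baseMeasure T r m) := by
  refine ⟨fun A hA hinv => ?_⟩
  have hA' : MeasurableSet {q | (lower T r q).1 ∈ A} := (measurable_lower T r).fst hA
  have hinv' : timeOne T r ⁻¹' {q | (lower T r q).1 ∈ A} = {q | (lower T r q).1 ∈ A} := by
    ext q
    obtain ⟨p, rfl⟩ := (isOpenQuotientMap_wrap T r).surjective q
    simp only [mem_preimage, mem_ofPred_eq]
    rw [show timeOne T r (wrap T r p) = wrap T r (p.1, p.2 + 1) from flowMap_wrap T r 1 p,
      fst_lower_mem_iff T r hinv, fst_lower_mem_iff T r hinv]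
  rw [Filter.eventuallyConst_set']
  rcases hm.toPreErgodic.measure_self_or_compl_eq_zero hA' hinv' with h | h
  · exact Or.inl (ae_eq_empty.2 (baseMeasure_le T r hA hinv h))
  · refine Or.inr (ae_eq_univ.2 (baseMeasure_le T r hA.compl ?_ h))
    rw [preimage_compl, hinv]

/-- The measure on `X_r` with base measure `ν`. -/
noncomputable def suspend (ν : Measure X) : Measure (Space T r) :=
  ((ν.prod volume).restrict (domain r)).map (wrap T r)

theorem lintegral_suspend (ν : Measure X) [SFinite ν] {h : Space T r → ENNReal}
    (hh : Measurable h) :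
    ∫⁻ q, h q ∂suspend T r ν =
      ∫⁻ x, ∫⁻ t : ℝ, (domain r).indicator (fun p => h (wrap T r p)) (x, t) ∂volume ∂ν := by
  have hmeas := hh.comp (measurable_wrap T r)
  rw [suspend, lintegral_map hh (measurable_wrap T r),
    ← lintegral_indicator (measurableSet_domain r)]
  exact lintegral_prod _ (hmeas.indicator (measurableSet_domain r)).aemeasurable

/-- The average is recovered from the base measure alone, by testing the product formula on
functions supported in the domain. -/
theorem flowAverage_eq_suspend {m : Measure (Space T r)} [IsProbabilityMeasure m]
    (hm : MeasurePreserving (timeOne T r) m m) :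
    flowAverage T r m = suspend T r (baseMeasure T r m) := by
  have := isFiniteMeasure_baseMeasure T r hm
  refine Measure.ext_of_lintegral _ fun h hh => ?_
  rw [lintegral_suspend T r _ hh, lintegral_baseMeasure T r hm
    (f := (domain r).indicator fun p => h (wrap T r p)) ((hh.comp (measurable_wrap T r)).indicator (measurableSet_domain r)), orbitSum_indicator]

theorem suspend_smul (ν : Measure X) [IsFiniteMeasure ν] (a : ENNReal) :
    suspend T r (a • ν) = a • suspend T r ν := by
  rw [suspend, Measure.prod_smul_left, Measure.restrict_smul, Measure.map_smul]
  rfl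

/-- If `T` has only countably many ergodic measures, then the averages along the flow of the
ergodic measures of the time-one map form a countable set. -/
theorem countable_flowAverage (herg : (ergodicMeasures T).Countable) :
    (flowAverage T r '' ergodicMeasures (timeOne T r)).Countable := by
  -- The normalisation absorbs the unknown mass of the base measure, which is only a multiple of an
  -- ergodic probability measure.
  refine (herg.image fun ν => (suspend T r ν univ)⁻¹ • suspend T r ν).mono ?_
  rintro _ ⟨m, ⟨hprob, hm⟩, rfl⟩
  have hfin := isFiniteMeasure_baseMeasure T r hm.toMeasurePreserving
  have hne := baseMeasure_ne_zero T r hm.toMeasurePreserving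
  set ν := baseMeasure T r m
  have : NeZero ν := ⟨hne⟩
  set a := (ν univ)⁻¹
  have ha0 : a ≠ 0 := ENNReal.inv_ne_zero.2 (measure_ne_top _ _)
  have hat : a ≠ ⊤ := ENNReal.inv_ne_top.2 (by simpa using hne)
  refine ⟨a • ν, ⟨isProbabilityMeasureSMul, ?_⟩, ?_⟩
  · refine ⟨(measurePreserving_baseMeasure T r hm.toMeasurePreserving).smul_measure a, ?_⟩
    refine ⟨fun A hA hinv => ?_⟩
    exact ((preErgodic_baseMeasure T r hm).aeconst_set hA hinv).anti
      (Measure.ae_smul_measure_le a)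
  · simp only
    rw [suspend_smul, ← flowAverage_eq_suspend T r hm.toMeasurePreserving, Measure.smul_apply,
      measure_univ, smul_eq_mul, mul_one, smul_smul, ENNReal.inv_mul_cancel ha0 hat, one_smul]

end Measures

end Suspension

/-! ### Eigenvalues of the Koopman operator and twisted ergodic averages. -/

section Koopman

variable {Y : Type*} [MeasurableSpace Y] {φ : Y → Y} {μ : Measure Y}

/-- The isometry `f ↦ z⁻¹ • (f ∘ φ)` of `L²(μ)`. -/
noncomputable def twistedKoopman (hφ : MeasurePreserving φ μ μ) (z : Circle) :
    Lp ℂ 2 μ →ₗᵢ[ℂ] Lp ℂ 2 μ where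
  toLinearMap := ((z⁻¹ : Circle) : ℂ) • (Lp.compMeasurePreservingₗᵢ ℂ φ hφ).toLinearMap
  norm_map' f := by
    change ‖((z⁻¹ : Circle) : ℂ) • Lp.compMeasurePreserving φ hφ f‖ = ‖f‖
    rw [norm_smul, Circle.norm_coe, one_mul, Lp.norm_compMeasurePreserving]

theorem twistedKoopman_apply (hφ : MeasurePreserving φ μ μ) (z : Circle) (u : Lp ℂ 2 μ) :
    twistedKoopman hφ z u = ((z⁻¹ : Circle) : ℂ) • Lp.compMeasurePreserving φ hφ u := rfl

theorem coeFn_twistedKoopman (hφ : MeasurePreserving φ μ μ) (z : Circle) (u : Lp ℂ 2 μ) :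
    twistedKoopman hφ z u =ᵐ[μ] fun x => ((z⁻¹ : Circle) : ℂ) * u (φ x) := by
  rw [twistedKoopman_apply]
  filter_upwards [Lp.coeFn_smul ((z⁻¹ : Circle) : ℂ) (Lp.compMeasurePreserving φ hφ u),
    Lp.coeFn_compMeasurePreserving u hφ] with x h1 h2
  rw [h1, Pi.smul_apply, h2, smul_eq_mul, Function.comp_apply]

/-- The twist turns eigenfunctions into fixed vectors, the objects of the mean ergodic theorem. -/
theorem mem_koopmanSpectrum_iff (hφ : MeasurePreserving φ μ μ) (z : Circle) :
    z ∈ koopmanSpectrum φ μ ↔ ∃ u : Lp ℂ 2 μ, u ≠ 0 ∧ twistedKoopman hφ z u = u := by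
  have hz : ∀ a b : ℂ, ((z⁻¹ : Circle) : ℂ) * a = b ↔ a = z * b := by
    intro a b
    rw [Circle.coe_inv, inv_mul_eq_iff_eq_mul₀ z.coe_ne_zero]
  constructor
  · rintro ⟨f, hf, hf0, hfz⟩
    refine ⟨hf.toLp f, fun h => hf0 ?_, ?_⟩
    · have := hf.coeFn_toLp
      rw [h] at this
      exact this.symm.trans (Lp.coeFn_zero _ _ _)
    · refine Lp.ext ((coeFn_twistedKoopman hφ z _).trans ?_)
      filter_upwards [hφ.quasiMeasurePreserving.ae_eq_comp hf.coeFn_toLp, hf.coeFn_toLp, hfz]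
        with x h1 h2 h3
      rw [hz, h2]
      exact h1.trans h3
  · rintro ⟨u, hu, hQ⟩
    refine ⟨u, Lp.memLp u, fun h => hu ?_, ?_⟩
    · exact Lp.ext (h.trans (Lp.coeFn_zero _ _ _).symm)
    · have h := coeFn_twistedKoopman hφ z u
      rw [hQ] at h
      filter_upwards [h] with x hx
      exact (hz _ _).1 hx.symm

/-- The point spectrum of a measure-preserving map of a space with countably generated
`σ`-algebra is countable. -/
theorem countable_koopmanSpectrum [MeasurableSpace.CountablyGenerated Y] [IsFiniteMeasure μ]
    (hφ : MeasurePreserving φ μ μ) : (koopmanSpectrum φ μ).Countable := by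
  have hnorm : ∀ z ∈ koopmanSpectrum φ μ,
      ∃ u : Lp ℂ 2 μ, ‖u‖ = 1 ∧ Lp.compMeasurePreserving φ hφ u = (z : ℂ) • u := by
    intro z hz
    obtain ⟨u, hu, hQ⟩ := (mem_koopmanSpectrum_iff hφ z).1 hz
    have hK : Lp.compMeasurePreservingₗᵢ ℂ φ hφ u = (z : ℂ) • u := by
      rw [twistedKoopman_apply, Circle.coe_inv, inv_smul_eq_iff₀ z.coe_ne_zero] at hQ
      exact hQ
    refine ⟨((‖u‖⁻¹ : ℝ) : ℂ) • u, ?_, ?_⟩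
    · rw [norm_smul]
      simp [hu]
    · change Lp.compMeasurePreservingₗᵢ ℂ φ hφ _ = _
      rw [map_smul, hK, smul_comm]
  choose! e he1 heK using hnorm
  -- The isometry multiplies the inner product by z⁻¹w, which is not 1, yet preserves it.
  have horth : ∀ z ∈ koopmanSpectrum φ μ, ∀ w ∈ koopmanSpectrum φ μ, z ≠ w →
      inner ℂ (e z) (e w) = 0 := by
    intro z hz w hw hzw
    have h := (Lp.compMeasurePreservingₗᵢ ℂ φ hφ).inner_map_map (e z) (e w)
    change inner ℂ (Lp.compMeasurePreserving φ hφ (e z)) (Lp.compMeasurePreserving φ hφ (e w)) = _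
      at h
    rw [heK z hz, heK w hw, inner_smul_left, inner_smul_right, ← mul_assoc,
      ← Circle.coe_inv_eq_conj, ← Circle.coe_mul] at h
    by_contra h0
    have h1 := mul_right_cancel₀ h0 (h.trans (one_mul _).symm)
    rw [← Circle.coe_one, Circle.coe_inj] at h1
    exact hzw (inv_mul_eq_one.1 h1)
  -- Orthonormal vectors are at distance √2 > 1.
  have hdisj : (koopmanSpectrum φ μ).PairwiseDisjoint fun z => Metric.ball (e z) (1 / 2) := by
    intro z hz w hw hzw
    refine Metric.ball_disjoint_ball ?_
    rw [dist_eq_norm]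
    have h := norm_sub_sq (𝕜 := ℂ) (e z) (e w)
    rw [horth z hz w hw hzw, he1 z hz, he1 w hw] at h
    simp only [map_zero] at h
    nlinarith [norm_nonneg (e z - e w)]
  -- Needed for separability of L², where disjoint nonempty open sets are countably many.
  have : Fact ((2 : ENNReal) ≠ ⊤) := ⟨by simp⟩
  exact hdisj.countable_of_isOpen (fun _ _ => Metric.isOpen_ball)
    fun z _ => ⟨e z, Metric.mem_ball_self (by norm_num)⟩

/-- The averages `(1/N) ∑_{k<N} z^{-k} g(φ^k q)`. -/
noncomputable def twistedMean (φ : Y → Y) (z : Circle) (g : Y → ℂ) (N : ℕ) (q : Y) : ℂ :=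
  (N : ℂ)⁻¹ * ∑ k ∈ Finset.range N, (((z⁻¹ : Circle) : ℂ) ^ k) * g (φ^[k] q)

theorem coeFn_iterate_twistedKoopman (hφ : MeasurePreserving φ μ μ) (z : Circle) {g : Y → ℂ}
    (hg : MemLp g 2 μ) (k : ℕ) : (twistedKoopman hφ z)^[k] (hg.toLp g) =ᵐ[μ]
      fun q => (((z⁻¹ : Circle) : ℂ) ^ k) * g (φ^[k] q) := by
  induction k with
  | zero =>
    filter_upwards [hg.coeFn_toLp] with q hq
    simpa using hq
  | succ k ih =>
    rw [Function.iterate_succ_apply']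
    filter_upwards [coeFn_twistedKoopman hφ z ((twistedKoopman hφ z)^[k] (hg.toLp g)),
      hφ.quasiMeasurePreserving.ae_eq_comp ih] with q h1 h2
    rw [Function.comp_apply, Function.comp_apply] at h2
    rw [h1, h2, Function.iterate_succ_apply, pow_succ]
    ring

theorem coeFn_birkhoffAverage (hφ : MeasurePreserving φ μ μ) (z : Circle) {g : Y → ℂ}
    (hg : MemLp g 2 μ) (N : ℕ) :
    (birkhoffAverage ℂ (twistedKoopman hφ z) id N (hg.toLp g) : Lp ℂ 2 μ) =ᵐ[μ]
      twistedMean φ z g N := by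
  have h2 : ∀ᵐ q ∂μ, ∀ k : ℕ, ((twistedKoopman hφ z)^[k] (hg.toLp g)) q =
      (((z⁻¹ : Circle) : ℂ) ^ k) * g (φ^[k] q) :=
    ae_all_iff.2 fun k => coeFn_iterate_twistedKoopman hφ z hg k
  rw [birkhoffAverage, birkhoffSum]
  filter_upwards [Lp.coeFn_smul ((N : ℂ)⁻¹)
    (∑ k ∈ Finset.range N, id ((twistedKoopman hφ z)^[k] (hg.toLp g))),
    Lp.coeFn_finsetSum (Finset.range N) fun k => id ((twistedKoopman hφ z)^[k] (hg.toLp g)), h2]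
    with q h3 h4 h5
  rw [h3, Pi.smul_apply, h4, twistedMean, smul_eq_mul, Finset.sum_apply]
  congr 1
  exact Finset.sum_congr rfl fun k _ => h5 k

theorem lintegral_twistedMean (hφ : MeasurePreserving φ μ μ) (z : Circle) {g : Y → ℂ}
    (hg : MemLp g 2 μ) (N : ℕ) : ∫⁻ q, ‖twistedMean φ z g N q‖ₑ ^ 2 ∂μ =
      ‖birkhoffAverage ℂ (twistedKoopman hφ z) id N (hg.toLp g)‖ₑ ^ 2 := by
  rw [Lp.enorm_def, eLpNorm_congr_ae (coeFn_birkhoffAverage hφ z hg N)]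
  have h := eLpNorm_nnreal_pow_eq_lintegral (f := twistedMean φ z g N) (μ := μ) (p := 2) (by simp)
  simpa using h.symm

/-- Von Neumann's theorem: the averages converge to the projection on the fixed space, which is
trivial when z is not an eigenvalue. -/
theorem tendsto_lintegral_twistedMean (hφ : MeasurePreserving φ μ μ) {z : Circle}
    (hz : z ∉ koopmanSpectrum φ μ) {g : Y → ℂ} (hg : MemLp g 2 μ) :
    Tendsto (fun N => ∫⁻ q, ‖twistedMean φ z g N q‖ₑ ^ 2 ∂μ) atTop (𝓝 0) := by
  have h := (twistedKoopman hφ z).toContinuousLinearMap.tendsto_birkhoffAverage_orthogonalProjection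
    (LinearIsometry.norm_toContinuousLinearMap_le _) (hg.toLp g)
  have hbot : ((twistedKoopman hφ z).toContinuousLinearMap).eqLocus
      (1 : Lp ℂ 2 μ →L[ℂ] Lp ℂ 2 μ) = ⊥ := by
    rw [eq_bot_iff]
    intro u hu
    by_contra h0
    exact hz ((mem_koopmanSpectrum_iff hφ z).2 ⟨u, h0, hu⟩)
  have h0 : ((((twistedKoopman hφ z).toContinuousLinearMap).eqLocus
      (1 : Lp ℂ 2 μ →L[ℂ] Lp ℂ 2 μ)).orthogonalProjectionOnto (hg.toLp g) : Lp ℂ 2 μ) = 0 := by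
    have := Submodule.coe_mem ((((twistedKoopman hφ z).toContinuousLinearMap).eqLocus
      (1 : Lp ℂ 2 μ →L[ℂ] Lp ℂ 2 μ)).orthogonalProjectionOnto (hg.toLp g))
    exact (Submodule.mem_bot ℂ).1 (hbot.le this)
  rw [h0] at h
  simp_rw [lintegral_twistedMean hφ z hg]
  have h1 := (ENNReal.continuous_pow 2).tendsto' 0 0 (by simp) |>.comp
    (continuous_enorm.tendsto' (0 : Lp ℂ 2 μ) 0 (by simp) |>.comp h)
  exact h1

/-- The averages of `g` are bounded below by the correlation of `g` with an eigenfunction. -/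
theorem enorm_inner_le_twistedMean (hφ : MeasurePreserving φ μ μ) {z : Circle} {u : Lp ℂ 2 μ}
    (hu : twistedKoopman hφ z u = u) {g : Y → ℂ} (hg : MemLp g 2 μ) {N : ℕ} (hN : N ≠ 0) :
    ‖inner ℂ u (hg.toLp g)‖ₑ ^ 2 ≤
      ‖u‖ₑ ^ 2 * ∫⁻ q, ‖twistedMean φ z g N q‖ₑ ^ 2 ∂μ := by
  -- The isometry fixes u, so pairing with u does not see it; no adjoint is needed.
  have hiter : ∀ k : ℕ, ∀ v, inner ℂ u ((twistedKoopman hφ z)^[k] v) = inner ℂ u v := by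
    intro k
    induction k with
    | zero => intro v; rfl
    | succ k ih =>
      intro v
      rw [Function.iterate_succ_apply, ih]
      conv_lhs => rw [← hu]
      exact (twistedKoopman hφ z).inner_map_map u v
  have hinner : inner ℂ u (birkhoffAverage ℂ (twistedKoopman hφ z) id N (hg.toLp g)) =
      inner ℂ u (hg.toLp g) := by
    rw [birkhoffAverage, birkhoffSum, inner_smul_right, inner_sum]
    simp only [id, hiter]
    rw [Finset.sum_const, Finset.card_range, nsmul_eq_mul,
      inv_mul_cancel_left₀ (Nat.cast_ne_zero.2 hN)]
  rw [lintegral_twistedMean hφ z hg, ← mul_pow, ← hinner]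
  gcongr
  rw [← ofReal_norm, ← ofReal_norm, ← ofReal_norm, ← ENNReal.ofReal_mul (norm_nonneg _)]
  exact ENNReal.ofReal_le_ofReal (norm_inner_le_norm _ _)

end Koopman

namespace Suspension

/-! ### Comparing the spectrum of a measure with that of its flow average. -/

section Spectrum

variable {X : Type*} [MetricSpace X] [CompactSpace X]
variable (T : X ≃ₜ X) (r : C(X, Set.Ioi (0 : ℝ)))

theorem commute_flowMap_timeOne (t : ℝ) :
    Function.Commute (flowMap T r t) (timeOne T r) := by
  intro q
  have h1 := (flow T r).map_add t 1 q
  have h2 := (flow T r).map_add 1 t q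
  rw [add_comm] at h1
  exact h1.symm.trans h2

theorem iterate_timeOne (n : ℕ) (q : Space T r) : (timeOne T r)^[n] q = flowMap T r n q := by
  induction n with
  | zero =>
    rw [Nat.cast_zero]
    exact ((flow T r).map_zero_apply q).symm
  | succ n ih =>
    rw [Function.iterate_succ_apply', ih, Nat.cast_succ, add_comm]
    exact ((flow T r).map_add 1 n q).symm

theorem twistedMean_flowMap (z : Circle) (g : Space T r → ℂ) (N : ℕ) (t : ℝ) (q : Space T r) :
    twistedMean (timeOne T r) z g N (flowMap T r t q) =
      twistedMean (timeOne T r) z (fun q => g (flowMap T r t q)) N q := by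
  simp only [twistedMean]
  congr 1
  refine Finset.sum_congr rfl fun k _ => ?_
  rw [((commute_flowMap_timeOne T r t).iterate_right k) q]

variable [MeasurableSpace X] [BorelSpace X]

theorem measurePreserving_flowAverage {m : Measure (Space T r)} [IsFiniteMeasure m]
    (hm : MeasurePreserving (timeOne T r) m m) :
    MeasurePreserving (timeOne T r) (flowAverage T r m) (flowAverage T r m) := by
  have hmeas : Measurable (timeOne T r) := (timeOne T r).continuous.measurable
  refine ⟨hmeas, Measure.ext_of_lintegral _ fun h hh => ?_⟩
  rw [lintegral_map hh hmeas, lintegral_flowAverage T r m (h := fun q => h (timeOne T r q))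
    (hh.comp hmeas), lintegral_flowAverage T r m hh]
  refine lintegral_congr fun t => ?_
  rw [← hm.lintegral_comp (f := fun q => h (flowMap T r t q))
    (hh.comp (continuous_flowMap T r t).measurable)]
  refine lintegral_congr fun q => ?_
  rw [← commute_flowMap_timeOne T r t q]

/-- The eigenvalues of the time-one map with respect to `m` are eigenvalues with respect to the
average of `m` along the flow. -/
theorem koopmanSpectrum_subset_flowAverage {m : Measure (Space T r)} [IsProbabilityMeasure m]
    (hm : MeasurePreserving (timeOne T r) m m) :
    koopmanSpectrum (timeOne T r) m ⊆ koopmanSpectrum (timeOne T r) (flowAverage T r m) := by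
  intro z hz
  by_contra hzl
  obtain ⟨u, hu0, hu⟩ := (mem_koopmanSpectrum_iff hm z).1 hz
  let := TopologicalSpace.metrizableSpaceMetric (Space T r)
  have hmem : ∀ (μ : Measure (Space T r)) [IsFiniteMeasure μ] (g : C(Space T r, ℂ)),
      MemLp g 2 μ := fun μ _ g => g.continuous.memLp_of_hasCompactSupport
        (HasCompactSupport.of_compactSpace g)
  -- Continuous functions are dense in L²(m), so orthogonality to all of them kills u.
  refine hu0 (DenseRange.eq_zero_of_inner_left ℂ
    (ContinuousMap.toLp_denseRange ℂ m ℂ (p := 2) (by simp)) fun g => ?_)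
  set G : ℝ → C(Space T r, ℂ) := fun t => g.comp ⟨flowMap T r t, continuous_flowMap T r t⟩
  set c : ℝ → ℂ := fun t => inner ℂ u ((hmem m (G t)).toLp (G t))
  have hc : Continuous c := by
    have hG : Continuous G := by
      refine ContinuousMap.continuous_of_continuous_uncurry _ ?_
      exact g.continuous.comp ((continuous_flowMap_uncurry T r).comp continuous_swap)
    have h1 : ∀ t, (hmem m (G t)).toLp (G t) = ContinuousMap.toLp 2 m ℂ (G t) := fun t => rfl
    simp only [c, h1]
    exact continuous_const.inner ((ContinuousMap.toLp 2 m ℂ).continuous.comp hG)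
  have hmean : ∀ N, Continuous (twistedMean (timeOne T r) z g N) := by
    intro N
    unfold twistedMean
    refine continuous_const.mul (continuous_finsetSum _ fun k _ => continuous_const.mul ?_)
    exact g.continuous.comp ((timeOne T r).continuous.iterate k)
  -- The squared L² norm for the average is the mean over t of those of g ∘ φ_t for m, each bounded
  -- below by its correlation with u.
  have hle : ∀ N : ℕ, N ≠ 0 → ∫⁻ t in Ico (0 : ℝ) 1, ‖c t‖ₑ ^ 2 ≤
      ‖u‖ₑ ^ 2 * ∫⁻ q, ‖twistedMean (timeOne T r) z g N q‖ₑ ^ 2 ∂flowAverage T r m := by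
    intro N hN
    rw [lintegral_flowAverage T r m ((hmean N).enorm.measurable.pow_const 2),
      ← lintegral_const_mul' _ _ (by simp)]
    refine lintegral_mono fun t => ?_
    simp_rw [twistedMean_flowMap]
    exact enorm_inner_le_twistedMean hm hu (hmem m (G t)) hN
  have hlim := ENNReal.Tendsto.const_mul (a := ‖u‖ₑ ^ 2) (tendsto_lintegral_twistedMean
    (measurePreserving_flowAverage T r hm) hzl (hmem (flowAverage T r m) g)) (Or.inr (by simp))
  rw [mul_zero] at hlim
  have hzero : ∫⁻ t in Ico (0 : ℝ) 1, ‖c t‖ₑ ^ 2 = 0 :=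
    le_antisymm (ge_of_tendsto hlim ((eventually_ne_atTop 0).mono hle)) zero_le
  rw [lintegral_eq_zero_iff (hc.enorm.measurable.pow_const 2)] at hzero
  have hae : c =ᵐ[volume.restrict (Ico (0 : ℝ) 1)] fun _ => 0 := by
    filter_upwards [hzero] with t ht
    simpa using ht
  -- Continuity upgrades almost every t to every t in [0, 1), in particular t = 0, where φ_t is the
  -- identity.
  have hon := Measure.eqOn_Ico_of_ae_eq volume hae hc.continuousOn continuousOn_const
  have h0 := hon (left_mem_Ico.2 zero_lt_one)
  have hG0 : G 0 = g := by
    ext q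
    exact congrArg g ((flow T r).map_zero_apply q)
  simp only [c, hG0] at h0
  exact h0

/-- A single countable set contains the spectrum of every ergodic measure, so it serves all μ and no
exceptional null set arises. -/
theorem hasAlmostCountableSpectrum_timeOne (herg : (ergodicMeasures T).Countable)
    (μ : Measure (Space T r)) : HasAlmostCountableSpectrum (timeOne T r) μ := by
  have : SecondCountableTopology (Space T r) :=
    (isOpenQuotientMap_wrap T r).isQuotientMap.secondCountableTopology
      (isOpenQuotientMap_wrap T r).isOpenMap
  refine ⟨⋃ l ∈ flowAverage T r '' ergodicMeasures (timeOne T r), koopmanSpectrum (timeOne T r) l,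
    (countable_flowAverage T r herg).biUnion ?_, fun τ _ => ae_of_all _ ?_⟩
  · rintro _ ⟨m, ⟨hprob, hm⟩, rfl⟩
    exact countable_koopmanSpectrum (measurePreserving_flowAverage T r hm.toMeasurePreserving)
  · rintro ⟨m, hprob, hm⟩
    exact (koopmanSpectrum_subset_flowAverage T r hm.toMeasurePreserving).trans
      (subset_biUnion_of_mem (mem_image_of_mem _ ⟨hprob, hm⟩))

end Spectrum

end Suspension

/-! ### Dynamical covers from finite codes, and covers of subexponential size. -/

namespace Dynamics

/-- A code with finitely many values such that points with the same code stay close gives a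
dynamical cover. -/
theorem coverMincard_le_card_of_code {Y κ : Type*} {φ : Y → Y} {U : SetRel Y Y} {n : ℕ}
    (code : Y → κ) (S : Finset κ) (hS : ∀ y, code y ∈ S)
    (h : ∀ y z, code y = code z → (y, z) ∈ dynEntourage φ U n) :
    coverMincard φ univ U n ≤ S.card := by
  classical
  rcases isEmpty_or_nonempty Y with hY | hY
  · have : (univ : Set Y) = ∅ := univ_eq_empty_iff.2 hY
    rw [this, coverMincard_empty]
    exact zero_le
  · let t : Finset Y := S.image (Function.invFun code)
    have ht : IsDynCoverOf φ univ U n (t : Set Y) := by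
      intro y _
      refine ⟨Function.invFun code (code y), ?_, h _ _ ?_⟩
      · exact Finset.mem_coe.2 (Finset.mem_image_of_mem _ (hS y))
      · exact (Function.invFun_eq ⟨y, rfl⟩).symm
    exact ht.coverMincard_le_card.trans (by exact_mod_cast Finset.card_image_le)

theorem ereal_exp_mul_natCast (a : ℝ) (n : ℕ) :
    EReal.exp ((a : EReal) * n) = ENNReal.ofReal (Real.exp (a * n)) := by
  rw [← EReal.exp_coe, EReal.coe_mul, EReal.coe_natCast]

/-- A map of zero entropy has dynamical covers of subexponential cardinality. -/
theorem eventually_exists_isDynCoverOf {Y : Type*} [UniformSpace Y] {φ : Y → Y}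
    (h : coverEntropy φ univ ≤ 0) {U : SetRel Y Y} (hU : U ∈ 𝓤 Y) {a : ℝ} (ha : 0 < a) :
    ∀ᶠ n : ℕ in atTop, ∃ s : Finset Y, IsDynCoverOf φ univ U n (s : Set Y) ∧
      (s.card : ℝ) ≤ Real.exp (a * n) := by
  have h1 : ExpGrowth.expGrowthSup (fun n : ℕ ↦ (coverMincard φ univ U n : ENNReal)) <
      (a : EReal) :=
    ((coverEntropyEntourage_le_coverEntropy φ univ hU).trans h).trans_lt (by exact_mod_cast ha)
  filter_upwards [ExpGrowth.eventually_le_exp h1] with n hn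
  rw [ereal_exp_mul_natCast] at hn
  have hfin : coverMincard φ univ U n < ⊤ := by
    rw [← ENat.toENNReal_lt_top]
    exact hn.trans_lt ENNReal.ofReal_lt_top
  obtain ⟨s, hs, hcard⟩ := (coverMincard_finite_iff φ univ U n).1 hfin
  refine ⟨s, hs, ?_⟩
  rw [← hcard] at hn
  simp only [ENat.toENNReal_coe] at hn
  rw [← ENNReal.ofReal_natCast] at hn
  exact (ENNReal.ofReal_le_ofReal_iff (Real.exp_pos _).le).1 hn

end Dynamics

namespace Suspension

/-! ### Zero entropy of the time-one map. -/

section Entropy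

set_option linter.unusedSectionVars false

variable {X : Type*} [MetricSpace X] [CompactSpace X]
variable (T : X ≃ₜ X) (r : C(X, Set.Ioi (0 : ℝ)))

theorem exists_roof_le : ∃ b : ℝ, 0 < b ∧ ∀ x, (r x : ℝ) ≤ b := by
  obtain ⟨b, hb⟩ := (isCompact_univ.image_of_continuousOn
    (f := fun x => (r x : ℝ)) (by fun_prop)).bddAbove
  exact ⟨max b 1, by positivity, fun x => (hb ⟨x, mem_univ _, rfl⟩).trans (le_max_left _ _)⟩

theorem roofSum_sub_le {b : ℝ} (hb : ∀ x, (r x : ℝ) ≤ b) {m n : ℤ} (hmn : m ≤ n) (x : X) :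
    roofSum T r n x - roofSum T r m x ≤ b * (n - m) := by
  induction n, hmn using Int.leInduction with
  | base => simp
  | succ n _ ih =>
    rw [roofSum_add_one]
    push_cast
    linarith [hb ((T ^ n) x)]

theorem iterate_eq_zpow (n : ℕ) (x : X) : T^[n] x = (T ^ (n : ℤ)) x := by
  induction n with
  | zero => rfl
  | succ n ih =>
    rw [Function.iterate_succ_apply', ih, Nat.cast_succ, add_comm, zpow_one_add]
    rfl

theorem exists_dist_lt_mem_of_continuous {Z : Type*} [UniformSpace Z] {f : X × ℝ → Z}
    (hf : Continuous f) (b : ℝ) {W : Set (Z × Z)} (hW : W ∈ 𝓤 Z) :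
    ∃ ρ > 0, ∀ x x' : X, ∀ s s' : ℝ, s ∈ Icc 0 b → dist x x' < ρ → |s - s'| < ρ →
      (f (x, s), f (x', s')) ∈ W := by
  -- The second height may leave [0, b]; the margin 1 contains it because ρ is cut down to at most
  -- 1.
  have hK : IsCompact (univ ×ˢ Icc (-1) (b + 1) : Set (X × ℝ)) :=
    isCompact_univ.prod isCompact_Icc
  have hu := hK.uniformContinuousOn_of_continuous hf.continuousOn
  have h1 := hu hW
  rw [mem_map, mem_inf_principal] at h1
  obtain ⟨ρ, hρ, h⟩ := Metric.mem_uniformity_dist.1 h1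
  refine ⟨min ρ 1, by positivity, fun x x' s s' hs hx hss => ?_⟩
  have h2 := abs_lt.1 (hss.trans_le (min_le_right _ _))
  refine h (a := (x, s)) (b := (x', s')) ?_ ⟨⟨mem_univ _, ?_, ?_⟩, ⟨mem_univ _, ?_, ?_⟩⟩
  · rw [Prod.dist_eq, Real.dist_eq]
    exact max_lt (hx.trans_le (min_le_left _ _)) (hss.trans_le (min_le_left _ _))
  all_goals simp only; linarith [hs.1, hs.2]

/-- Base points whose orbits and roof sums stay close have orbits under the time-one map that
stay close. -/
theorem iterate_timeOne_mem {b c ρ η : ℝ} (hr : ∀ x, c ≤ r x)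
    (hb : ∀ x, (r x : ℝ) ≤ b) {W : Set (Space T r × Space T r)}
    (hW : ∀ x x' : X, ∀ s s' : ℝ, s ∈ Icc 0 b → dist x x' < ρ → |s - s'| < ρ →
      (wrap T r (x, s), wrap T r (x', s')) ∈ W)
    (hηρ : 3 * η ≤ ρ) {n : ℕ} {x x' : X}
    (hx : ∀ i < n, dist (T^[i] x) (T^[i] x') < ρ)
    (hsum : ∀ i ≤ n, |roofSum T r i x - roofSum T r i x'| ≤ 2 * η) {s s' : ℝ}
    (hs : (x, s) ∈ domain r) (hss : |s - s'| < η) {t : ℕ} (ht : b + t < c * n) :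
    ((timeOne T r)^[t] (wrap T r (x, s)), (timeOne T r)^[t] (wrap T r (x', s'))) ∈ W := by
  have hs1 : 0 ≤ s := hs.1
  have hs2 : s < r x := hs.2
  have hspec := index_spec T r x (s + t)
  rw [iterate_timeOne, iterate_timeOne, flowMap_wrap, flowMap_wrap]
  -- Both points are moved by the power that normalises the first. The second may miss the domain,
  -- but `wrap` sees only its orbit.
  rw [← wrap_zpow T r (index T r x (s + t)) (x, s + t),
    ← wrap_zpow T r (index T r x (s + t)) (x', s' + t)]
  set i := index T r x (s + t)
  have ht0 : (0 : ℝ) ≤ t := t.cast_nonneg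
  have hi0 : 0 ≤ i := by
    by_contra! hi
    have := roofSum_mono T r (show i + 1 ≤ 0 by omega) x
    rw [roofSum_zero] at this
    linarith
  -- Making n returns takes flow time at least c * n, more than b + t.
  have hin : i < n := by
    by_contra! hi
    have h1 := le_roofSum_sub T r hr (m := 0) (n := n) (by omega) x
    have h2 := roofSum_mono T r hi x
    simp only [roofSum_zero, Int.cast_natCast, Int.cast_zero] at h1
    linarith [hb x]
  obtain ⟨k, hk⟩ := Int.eq_ofNat_of_zero_le hi0
  rw [hk] at hin hspec ⊢
  have hkn : k < n := by omega
  rw [shift_zpow, shift_zpow]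
  have h3 := hsum k hkn.le
  have h4 : |s - s' - (roofSum T r k x - roofSum T r k x')| < ρ :=
    (abs_sub _ _).trans_lt (by linarith)
  refine hW _ _ _ _ ?_ ?_ ?_
  · rw [roofSum_add_one] at hspec
    constructor
    · simp only; linarith
    · simp only; linarith [hb ((T ^ (k : ℤ)) x)]
  · simp only
    rw [← iterate_eq_zpow, ← iterate_eq_zpow]
    exact hx k hkn
  · simp only
    convert h4 using 2
    ring

/-- Roof sums start at 0, so equal rounded increments give equal floors at block ends and an error η
there. Inside a block, at most L steps add η / L each. -/
theorem abs_roofSum_sub_le {η : ℝ} (hη : 0 < η) {L n : ℕ} (hL : 0 < L) {x x' : X}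
    (hx : ∀ i < n, |(r (T^[i] x) : ℝ) - r (T^[i] x')| ≤ η / L)
    (hfloor : ∀ j < n / L,
      ⌊roofSum T r ((j + 1) * L : ℕ) x / η⌋ - ⌊roofSum T r (j * L : ℕ) x / η⌋ =
      ⌊roofSum T r ((j + 1) * L : ℕ) x' / η⌋ - ⌊roofSum T r (j * L : ℕ) x' / η⌋) :
    ∀ i ≤ n, |roofSum T r i x - roofSum T r i x'| ≤ 2 * η := by
  have hblock : ∀ j ≤ n / L,
      ⌊roofSum T r (j * L : ℕ) x / η⌋ = ⌊roofSum T r (j * L : ℕ) x' / η⌋ := by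
    intro j
    induction j with
    | zero => simp
    | succ j ih =>
      intro hj
      have h1 := hfloor j (by omega)
      have h2 := ih (by omega)
      omega
  have hstart : ∀ j ≤ n / L,
      |roofSum T r (j * L : ℕ) x - roofSum T r (j * L : ℕ) x'| ≤ η := by
    intro j hj
    have h := Int.abs_sub_lt_one_of_floor_eq_floor (hblock j hj)
    rw [← sub_div, abs_div, abs_of_pos hη, div_lt_one hη] at h
    exact h.le
  have hstep : ∀ j ≤ n / L, ∀ k : ℕ, j * L + k ≤ n →
      |roofSum T r (j * L + k : ℕ) x - roofSum T r (j * L + k : ℕ) x'| ≤ η + k * (η / L) := by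
    intro j hj k
    induction k with
    | zero => intro _; simpa using hstart j hj
    | succ k ih =>
      intro hk
      have h1 := ih (by omega)
      have h2 := hx (j * L + k) (by omega)
      rw [← add_assoc, Nat.cast_succ, roofSum_add_one, roofSum_add_one, ← iterate_eq_zpow,
        ← iterate_eq_zpow, add_sub_add_comm]
      refine (abs_add_le _ _).trans ?_
      push_cast at h1 h2 ⊢
      linarith
  intro i hi
  have h := hstep (i / L) (Nat.div_le_div_right hi) (i % L)
    (by rw [Nat.div_add_mod']; exact hi)
  rw [Nat.div_add_mod'] at h
  refine h.trans ?_
  have hLr : (0 : ℝ) < L := Nat.cast_pos.2 hL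
  have h1 : ((i % L : ℕ) : ℝ) ≤ L := by exact_mod_cast (Nat.mod_lt i hL).le
  have h2 : ((i % L : ℕ) : ℝ) * (η / L) ≤ L * (η / L) := by gcongr
  rw [mul_div_cancel₀ _ hLr.ne'] at h2
  linarith

/-- The number of dynamical balls of the time-one map needed to cover `X_r`, in terms of a dynamical
cover of `X`. -/
theorem coverMincard_timeOne_le {b c ρ η δ : ℝ} (hr : ∀ x, c ≤ r x)
    (hb0 : 0 < b) (hb : ∀ x, (r x : ℝ) ≤ b) {W : Set (Space T r × Space T r)}
    (hW : ∀ x x' : X, ∀ s s' : ℝ, s ∈ Icc 0 b → dist x x' < ρ → |s - s'| < ρ →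
      (wrap T r (x, s), wrap T r (x', s')) ∈ W)
    (hη : 0 < η) (hηρ : 3 * η ≤ ρ) {L n N M : ℕ} (hL : 0 < L) (hδρ : 2 * δ ≤ ρ)
    (hδ : ∀ x x' : X, dist x x' < 2 * δ → |(r x : ℝ) - r x'| ≤ η / L)
    (hM : L * b / η + 1 < M) (hn : b + N ≤ c * n) {S : Finset X}
    (hS : Dynamics.IsDynCoverOf T univ {p | dist p.1 p.2 < δ} n (S : Set X)) :
    Dynamics.coverMincard (timeOne T r) univ W N ≤ (S.card * M ^ (n / L + 1) : ℕ) := by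
  have hcenter : ∀ x : X, ∃ a ∈ S, ∀ i < n, dist (T^[i] x) (T^[i] a) < δ := by
    intro x
    obtain ⟨a, ha, hxa⟩ := hS (mem_univ x)
    exact ⟨a, ha, fun i hi => Dynamics.mem_dynEntourage.1 hxa i hi⟩
  choose a haS ha using hcenter
  have hLb : b / η ≤ L * b / η := by
    have : (1 : ℝ) ≤ L := by exact_mod_cast hL
    gcongr
    exact le_mul_of_one_le_left hb0.le this
  -- Increments over a block take at most M values, whereas the floors themselves grow with the
  -- orbit length.
  let incr : X → ℕ → ℤ := fun x j =>
    ⌊roofSum T r ((j + 1) * L : ℕ) x / η⌋ - ⌊roofSum T r (j * L : ℕ) x / η⌋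
  have hincr : ∀ x j, incr x j ∈ Finset.Ico (0 : ℤ) M := by
    intro x j
    have hle : ((j * L : ℕ) : ℤ) ≤ ((j + 1) * L : ℕ) := by
      exact_mod_cast Nat.mul_le_mul_right L (Nat.le_succ j)
    rw [Finset.mem_Ico]
    constructor
    · refine sub_nonneg.2 (Int.floor_mono ?_)
      have := roofSum_mono T r hle x
      gcongr
    · have h1 := roofSum_sub_le T r hb hle x
      have h2 := Int.floor_le (roofSum T r ((j + 1) * L : ℕ) x / η)
      have h3 := Int.lt_floor_add_one (roofSum T r (j * L : ℕ) x / η)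
      have h4 : roofSum T r ((j + 1) * L : ℕ) x / η - roofSum T r (j * L : ℕ) x / η ≤
          L * b / η := by
        rw [← sub_div]
        gcongr
        refine h1.trans (le_of_eq ?_)
        push_cast
        ring
      have h5 : ((incr x j : ℤ) : ℝ) < ((M : ℤ) : ℝ) := by
        simp only [incr]
        push_cast at h2 h3 h4 ⊢
        linarith
      exact_mod_cast h5
  -- The height uses the same alphabet of M values, which accounts for the + 1 in the exponent.
  let code : Space T r → X × (Fin (n / L) → ℤ) × ℤ := fun q =>
    (a (lower T r q).1, fun j => incr (lower T r q).1 j, ⌊(lower T r q).2 / η⌋)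
  refine (Dynamics.coverMincard_le_card_of_code code
    (S ×ˢ (Fintype.piFinset (fun _ => Finset.Ico (0 : ℤ) M)) ×ˢ Finset.Ico (0 : ℤ) M)
    ?_ ?_).trans (le_of_eq ?_)
  · intro q
    have hq := lower_mem_domain T r q
    refine Finset.mem_product.2 ⟨haS _, Finset.mem_product.2 ⟨Fintype.mem_piFinset.2 fun j =>
      hincr _ _, Finset.mem_Ico.2 ⟨?_, ?_⟩⟩⟩
    · exact Int.floor_nonneg.2 (div_nonneg hq.1 hη.le)
    · have h1 := Int.floor_le ((lower T r q).2 / η)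
      have h2 : (lower T r q).2 / η ≤ b / η := by
        have := hq.2.le.trans (hb _)
        gcongr
      have h3 : ((⌊(lower T r q).2 / η⌋ : ℤ) : ℝ) < ((M : ℤ) : ℝ) := by
        push_cast
        linarith
      exact_mod_cast h3
  · intro q q' hqq
    obtain ⟨h1, h23⟩ := Prod.ext_iff.1 hqq
    obtain ⟨h2, h3⟩ := Prod.ext_iff.1 h23
    simp only [code] at h1 h2 h3
    rw [← wrap_lower T r q, ← wrap_lower T r q']
    have hdist : ∀ i < n, dist (T^[i] (lower T r q).1) (T^[i] (lower T r q').1) < 2 * δ := by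
      intro i hi
      have h4 := ha (lower T r q).1 i hi
      have h5 := ha (lower T r q').1 i hi
      rw [← h1, dist_comm] at h5
      linarith [dist_triangle (T^[i] (lower T r q).1) (T^[i] (a (lower T r q).1))
        (T^[i] (lower T r q').1)]
    refine Dynamics.mem_dynEntourage.2 fun t ht => ?_
    refine iterate_timeOne_mem T r hr hb hW hηρ
      (fun i hi => (hdist i hi).trans_le hδρ)
      (abs_roofSum_sub_le T r hη hL (fun i hi => hδ _ _ (hdist i hi)) fun j hj => ?_)
      (lower_mem_domain T r q) ?_ ?_ (n := n)
    · exact congrFun h2 ⟨j, hj⟩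
    · have h := Int.abs_sub_lt_one_of_floor_eq_floor h3
      rwa [← sub_div, abs_div, abs_of_pos hη, div_lt_one hη] at h
    · have : (t : ℝ) < N := by exact_mod_cast ht
      linarith
  · rw [Finset.card_product, Finset.card_product, Fintype.card_piFinset_const]
    simp [pow_succ]

/-- The time-one map of a suspension flow over a map of zero entropy has zero entropy. -/
theorem topologicalEntropy_timeOne (hent : topologicalEntropy T = 0) :
    topologicalEntropy (timeOne T r) = 0 := by
  rw [topologicalEntropy_eq] at hent
  -- The entropy of the empty system is ⊥, not 0.
  have hne : Nonempty X := by
    by_contra h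
    rw [not_nonempty_iff] at h
    rw [univ_eq_empty_iff.2 h, Dynamics.coverEntropy_empty] at hent
    exact EReal.bot_ne_zero hent
  obtain ⟨c, hc, hr⟩ := exists_pos_le_roof r
  obtain ⟨b, hb0, hb⟩ := exists_roof_le r
  have hwrap := continuous_wrap T r
  have hneY : Nonempty (Space T r) := hne.map fun x => wrap T r (x, 0)
  unfold topologicalEntropy
  let := uniformSpaceOfCompactR1 (γ := Space T r)
  refine le_antisymm (iSup₂_le fun W hW => ?_) (Dynamics.coverEntropy_nonneg _ univ_nonempty)
  obtain ⟨ρ, hρ, hWρ⟩ := exists_dist_lt_mem_of_continuous hwrap b hW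
  refine EReal.le_of_forall_lt_iff_le.1 fun ε hε => ?_
  have hε : 0 < ε := by exact_mod_cast hε
  refine Eventually.expGrowthSup_le ?_
  -- One η for the initial heights and 2η for the roof sums.
  set η := ρ / 3
  have hη : 0 < η := by positivity
  -- The base cover and the block codes each cost κ per base step. With n about N / c this is a rate
  -- ε / 4 in N, leaving room for the constants.
  set κ := ε * c / 8
  have hκ : 0 < κ := by positivity
  set K := b / η + 3
  have hK : 0 < K := by positivity
  obtain ⟨L, hL, hLlog⟩ : ∃ L : ℕ, 0 < L ∧ Real.log (K * L) ≤ κ * L := by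
    have h1 := Real.isLittleO_log_id_atTop.def (c := κ / K) (by positivity)
    have h2 : Tendsto (fun L : ℕ => K * (L : ℝ)) atTop atTop :=
      tendsto_natCast_atTop_atTop.const_mul_atTop hK
    obtain ⟨L, h3, h4⟩ := ((h2.eventually h1).and (eventually_gt_atTop 0)).exists
    refine ⟨L, h4, (le_abs_self _).trans (h3.trans (le_of_eq ?_))⟩
    rw [id, Real.norm_of_nonneg (by positivity)]
    field_simp
  have hL1 : (1 : ℝ) ≤ L := by exact_mod_cast hL
  -- A difference of floors over a block is below L * b / η + 1, and M ≤ K * L.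
  set M := ⌊L * b / η⌋₊ + 2
  have hM : L * b / η + 1 < M := by
    have := Nat.lt_floor_add_one (L * b / η)
    simp only [M]
    push_cast
    linarith
  have hM1 : (1 : ℝ) ≤ M := by
    have : 0 ≤ L * b / η := by positivity
    linarith
  have hMlog : Real.log M ≤ κ * L := by
    refine (Real.log_le_log (by linarith) ?_).trans hLlog
    have := Nat.floor_le (show 0 ≤ L * b / η by positivity)
    have h1 : K * L = L * b / η + 3 * L := by
      simp only [K]
      ring
    simp only [M]
    push_cast
    linarith
  obtain ⟨δ, hδ, hδρ, hδr⟩ : ∃ δ > 0, 2 * δ ≤ ρ ∧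
      ∀ x x' : X, dist x x' < 2 * δ → |(r x : ℝ) - r x'| ≤ η / L := by
    have hu : UniformContinuous fun x => (r x : ℝ) :=
      CompactSpace.uniformContinuous_of_continuous (by fun_prop)
    obtain ⟨δ, hδ, h⟩ := Metric.uniformContinuous_iff.1 hu (η / L) (by positivity)
    refine ⟨min δ ρ / 2, by positivity, ?_, fun x x' hx => ?_⟩
    · linarith [min_le_right δ ρ]
    · rw [← Real.dist_eq]
      exact (h (hx.trans_le (by linarith [min_le_left δ ρ]))).le
  have hcov := Dynamics.eventually_exists_isDynCoverOf hent.le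
    (U := {p : X × X | dist p.1 p.2 < δ}) (Metric.dist_mem_uniformity hδ) hκ
  -- The number of base steps that covers flow time N from any starting height.
  have hn : Tendsto (fun N : ℕ => ⌈(b + N) / c⌉₊) atTop atTop :=
    tendsto_nat_ceil_atTop.comp
      ((tendsto_atTop_add_const_left _ b tendsto_natCast_atTop_atTop).atTop_div_const hc)
  filter_upwards [hn.eventually hcov, (tendsto_natCast_atTop_atTop (R := ℝ)).eventually
    (eventually_ge_atTop ((ε / 4 * (b + c) + Real.log M) / (ε / 2)))] with N hN hNlarge
  obtain ⟨S, hS, hScard⟩ := hN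
  set n := ⌈(b + N) / c⌉₊
  have hbN : b + N ≤ c * n := by
    rw [mul_comm, ← div_le_iff₀ hc]
    exact Nat.le_ceil _
  have hcn : c * n ≤ b + N + c := by
    have := (Nat.ceil_lt_add_one (show 0 ≤ (b + N) / c by positivity)).le
    calc c * n ≤ c * ((b + N) / c + 1) := by gcongr
      _ = b + N + c := by field_simp
  have hmin := coverMincard_timeOne_le T r hr hb0 hb hWρ hη (by simp only [η]; linarith) hL hδρ
    hδr hM hbN hS
  rw [Dynamics.ereal_exp_mul_natCast]
  refine (ENat.toENNReal_mono hmin).trans ?_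
  rw [ENat.toENNReal_coe, ← ENNReal.ofReal_natCast]
  refine ENNReal.ofReal_le_ofReal ?_
  push_cast
  have hpow : (M : ℝ) ^ (n / L + 1) ≤ Real.exp (κ * n + Real.log M) := by
    rw [pow_succ, Real.exp_add, Real.exp_log (by linarith)]
    gcongr
    rw [← Real.exp_log (show (0 : ℝ) < M by linarith), ← Real.exp_nat_mul]
    refine Real.exp_le_exp.2 ?_
    have h1 : ((n / L : ℕ) : ℝ) * L ≤ n := by exact_mod_cast Nat.div_mul_le_self n L
    calc ((n / L : ℕ) : ℝ) * Real.log M ≤ ((n / L : ℕ) : ℝ) * (κ * L) := by gcongr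
      _ = κ * (((n / L : ℕ) : ℝ) * L) := by ring
      _ ≤ κ * n := by gcongr
  calc (S.card : ℝ) * (M : ℝ) ^ (n / L + 1)
      ≤ Real.exp (κ * n) * Real.exp (κ * n + Real.log M) := by gcongr
    _ = Real.exp (κ * n + (κ * n + Real.log M)) := (Real.exp_add _ _).symm
    _ ≤ Real.exp (ε * N) := by
      refine Real.exp_le_exp.2 ?_
      rw [div_le_iff₀ (by positivity)] at hNlarge
      have h1 : κ * n = ε / 8 * (c * n) := by
        simp only [κ]
        ring
      have h2 : ε / 8 * (c * n) ≤ ε / 8 * (b + N + c) := by gcongr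
      have h3 : 0 ≤ ε * N := by positivity
      rw [h1]
      linarith

end Entropy

end Suspension

theorem proposition5p3 {X : Type*} [MetricSpace X] [CompactSpace X] [MeasurableSpace X]
    [BorelSpace X] (T : X ≃ₜ X) (hent : topologicalEntropy T = 0)
    (herg : (ergodicMeasures T).Countable) (r : C(X, Set.Ioi (0 : ℝ))) :
    topologicalEntropy (Suspension.timeOne T r) = 0 ∧
      ∀ μ ∈ invariantMeasures (Suspension.timeOne T r),
        HasAlmostCountableSpectrum (Suspension.timeOne T r) μ :=
  ⟨Suspension.topologicalEntropy_timeOne T r hent,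
    fun μ _ => Suspension.hasAlmostCountableSpectrum_timeOne T r herg μ⟩
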